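/- For positive integers $n,q$ and an integer $a\ge 0$ let $\Omega(n;q,a)$ be the number of prime factors $p$ of $n$, counted with multiplicity, such that $p\equiv a \pmod q$, and put $\lambda(n;q,a)=(-1)^{\Omega(n;q,a)}$. Below, $x$ is real and sums run over positive integers $n\le x$. (a) Unconditionally, $\sum_{n\le x}\lambda(n;2,1)=o(x)$ as $x\to\infty$. If the Riemann hypothesis holds, then for every $\epsilon>0$ $$\sum_{n\le x}\lambda(n;2,1)=O_\epsilon\left(x^{1/2+\epsilon}\right)\qquad (x\ge 1),$$ that is, there is a constant $C$ depending only on $\epsilon$ such that $\left|\sum_{n\le x}\lambda(n;2,1)\right|\le C\,x^{1/2+\epsilon}$ for all $x\ge 1$. (b) Unconditionally, $\sum_{n\le x}\lambda(n;2,2)=\frac13x+o(x)$ as $x\to\infty$, and $\sum_{n\le x}\lambda(n;2,2)\ge 0$ for all $x\ge 1$. -/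

import Mathlib

/-- `Ω(n; q, a)`: the number of prime factors of `n`, counted with multiplicity,
that are congruent to `a` modulo `q`. -/
def bigOmegaAP (n q a : ℕ) : ℕ :=
  n.primeFactorsList.countP (fun p => p ≡ a [MOD q])

/-- `λ(n; q, a) = (-1) ^ Ω(n; q, a)`. -/
def liouvilleAP (n q a : ℕ) : ℤ :=
  (-1) ^ bigOmegaAP n q a

/-- `L(x; q, a) = ∑_{n ≤ x} λ(n; q, a)`, over the positive integers `n ≤ x`, for real `x`. -/
noncomputable def sumLiouvilleAP (x : ℝ) (q a : ℕ) : ℤ :=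
  ∑ n ∈ Finset.Icc 1 ⌊x⌋₊, liouvilleAP n q a

/-! ### Multiplicativity of `liouvilleAP`, the recursion for residue 2, and the Euler product. -/

section

open Filter Asymptotics Topology

/-! Write `L` for the summatory function. Modulo 2, the residue 2 singles out the prime 2, so odd
`n` contribute 1 and `2n` contributes minus the value at `n`. Hence `L(2m) = m - L(m)` and `L(2m+1)
= m + 1 - L(m)`. Strong induction gives `0 ≤ L(N) ≤ N`, and `L(N) - N/3` changes sign with a bounded
error at each halving, so it is `O(log N)`.

The residue 1 singles out the odd primes. Comparing Euler products, the Dirichlet series equals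
`ζ(2s)/ζ(s)` times the factor `(1 + 2^(-s))/(1 - 2^(-s))` correcting the prime 2
(`LSeries_liouvilleAP_eq`). To the right of `Re s = 1/2` its only possible singularities are zeros
of `ζ`. All of the analysis uses the entire function `riemannZeta₁`, equal to `(s - 1) ζ(s)` away
from 1, so that the pole needs no separate treatment.

Unconditionally, `ζ` does not vanish on `Re s ≥ 1`, so the series extends continuously to that
closed half plane. A Tauberian theorem in the style of Wiener and Ikehara
(`tendsto_zero_of_laplace_continuousOn`) then gives `o(x)`: averages against a band-limited kernel
tend to 0 by the Riemann–Lebesgue lemma, and slow oscillation transfers this to the function itself.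

Under RH, Littlewood's argument bounds `1/ζ(s)` by `|t|^η` for large `|t|` to the right of the
critical line: Borel–Carathéodory bounds `log ζ`, and Hadamard's three circles theorem lowers the
bound to a power of `log |t|` below the first (`exists_norm_inv_le_exp_rpow`). Perron's formula with
weights `X - n` converges absolutely, its contour moves to `Re s = 1/2 + 2δ`, and differencing over
a short interval recovers the unweighted sum (`exists_norm_sum_le_of_LSeries_growth`). -/

lemma bigOmegaAP_mul {m n : ℕ} (hm : m ≠ 0) (hn : n ≠ 0) (q a : ℕ) :
    bigOmegaAP (m * n) q a = bigOmegaAP m q a + bigOmegaAP n q a := by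
  unfold bigOmegaAP
  rw [(Nat.perm_primeFactorsList_mul hm hn).countP_eq, List.countP_append]

lemma liouvilleAP_mul {m n : ℕ} (hm : m ≠ 0) (hn : n ≠ 0) (q a : ℕ) :
    liouvilleAP (m * n) q a = liouvilleAP m q a * liouvilleAP n q a := by
  unfold liouvilleAP
  rw [bigOmegaAP_mul hm hn, pow_add]

@[simp]
lemma liouvilleAP_one (q a : ℕ) : liouvilleAP 1 q a = 1 := by
  simp [liouvilleAP, bigOmegaAP]

lemma liouvilleAP_prime {p : ℕ} (hp : p.Prime) (q a : ℕ) :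
    liouvilleAP p q a = if p ≡ a [MOD q] then -1 else 1 := by
  unfold liouvilleAP bigOmegaAP
  rw [Nat.primeFactorsList_prime hp, List.countP_singleton]
  split_ifs <;> simp_all

lemma abs_liouvilleAP (n q a : ℕ) : |liouvilleAP n q a| = 1 := by
  simp [liouvilleAP, abs_pow]

lemma norm_liouvilleAP (n q a : ℕ) : ‖(liouvilleAP n q a : ℂ)‖ = 1 := by
  rw [Complex.norm_intCast]
  exact_mod_cast abs_liouvilleAP n q a

lemma liouvilleAP_two_two_of_odd {n : ℕ} (hn : Odd n) : liouvilleAP n 2 2 = 1 := by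
  have : bigOmegaAP n 2 2 = 0 := by
    unfold bigOmegaAP
    rw [List.countP_eq_zero]
    intro p hp
    have h1 : Odd p := Odd.of_dvd_nat hn (Nat.dvd_of_mem_primeFactorsList hp)
    obtain ⟨k, rfl⟩ := h1
    simp only [decide_eq_true_eq]
    unfold Nat.ModEq
    omega
  simp [liouvilleAP, this]

lemma liouvilleAP_two_two_two_mul {n : ℕ} (hn : n ≠ 0) :
    liouvilleAP (2 * n) 2 2 = -liouvilleAP n 2 2 := by
  rw [liouvilleAP_mul two_ne_zero hn, liouvilleAP_prime Nat.prime_two]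
  simp [Nat.ModEq]

lemma sum_liouvilleAP_two_two_two_mul (m : ℕ) :
    ∑ n ∈ Finset.Icc 1 (2 * m), liouvilleAP n 2 2 =
      m - ∑ n ∈ Finset.Icc 1 m, liouvilleAP n 2 2 := by
  induction m with
  | zero => simp
  | succ m ih =>
    rw [show 2 * (m + 1) = 2 * m + 1 + 1 by ring, Finset.sum_Icc_succ_top (by omega),
      Finset.sum_Icc_succ_top (by omega), Finset.sum_Icc_succ_top (by omega), ih,
      liouvilleAP_two_two_of_odd ⟨m, rfl⟩, show 2 * m + 1 + 1 = 2 * (m + 1) by ring,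
      liouvilleAP_two_two_two_mul (by omega)]
    push_cast
    ring

lemma sum_liouvilleAP_two_two_two_mul_add_one (m : ℕ) :
    ∑ n ∈ Finset.Icc 1 (2 * m + 1), liouvilleAP n 2 2 =
      m + 1 - ∑ n ∈ Finset.Icc 1 m, liouvilleAP n 2 2 := by
  rw [Finset.sum_Icc_succ_top (by omega), sum_liouvilleAP_two_two_two_mul,
    liouvilleAP_two_two_of_odd ⟨m, rfl⟩]
  ring

lemma sum_liouvilleAP_two_two_mem_Icc (N : ℕ) :
    0 ≤ ∑ n ∈ Finset.Icc 1 N, liouvilleAP n 2 2 ∧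
      ∑ n ∈ Finset.Icc 1 N, liouvilleAP n 2 2 ≤ N := by
  induction N using Nat.strong_induction_on with
  | _ N ih =>
    rcases Nat.even_or_odd' N with ⟨m, rfl | rfl⟩
    · rcases Nat.eq_zero_or_pos m with rfl | hm
      · simp
      · have := ih m (by omega)
        rw [sum_liouvilleAP_two_two_two_mul]
        push_cast
        omega
    · have := ih m (by omega)
      rw [sum_liouvilleAP_two_two_two_mul_add_one]
      push_cast
      omega

/-- With `E(N) = L(N) - N/3` the recursion reads `E(2m) = -E(m)` and `E(2m+1) = 2/3 - E(m)`, so each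
halving costs less than 1. -/
lemma abs_sum_liouvilleAP_two_two_sub_le (N : ℕ) :
    |((∑ n ∈ Finset.Icc 1 N, liouvilleAP n 2 2 : ℤ) : ℝ) - N / 3| ≤ Nat.log 2 N + 1 := by
  induction N using Nat.strong_induction_on with
  | _ N ih =>
    rcases lt_or_ge N 2 with h | h
    · interval_cases N <;> norm_num
    have hlog : (Nat.log 2 N : ℝ) = Nat.log 2 (N / 2) + 1 := by
      rw [Nat.log_of_one_lt_of_le one_lt_two h]
      push_cast
      ring
    rcases Nat.even_or_odd' N with ⟨m, rfl | rfl⟩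
    · have := ih m (by omega)
      rw [show 2 * m / 2 = m by omega] at hlog
      rw [sum_liouvilleAP_two_two_two_mul, hlog]
      rw [abs_le] at this ⊢
      push_cast at this ⊢
      constructor <;> linarith
    · have := ih m (by omega)
      rw [show (2 * m + 1) / 2 = m by omega] at hlog
      rw [sum_liouvilleAP_two_two_two_mul_add_one, hlog]
      rw [abs_le] at this ⊢
      push_cast at this ⊢
      constructor <;> linarith

lemma sumLiouvilleAP_two_two_nonneg (x : ℝ) : 0 ≤ sumLiouvilleAP x 2 2 :=
  (sum_liouvilleAP_two_two_mem_Icc _).1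

lemma sumLiouvilleAP_two_two_isLittleO :
    (fun x : ℝ => (sumLiouvilleAP x 2 2 : ℝ) - 1 / 3 * x) =o[atTop] (fun x : ℝ => x) := by
  have hlog : (fun x : ℝ => Real.log x) =o[atTop] (fun x : ℝ => x) := Real.isLittleO_log_id_atTop
  have h1 : (fun _ : ℝ => (2 : ℝ)) =o[atTop] (fun x : ℝ => x) :=
    isLittleO_const_id_atTop 2
  refine IsBigO.trans_isLittleO ?_ (h1.add (hlog.const_mul_left (1 / Real.log 2)))
  refine IsBigO.of_bound 1 ?_
  filter_upwards [eventually_ge_atTop 1] with x hx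
  have hN : ⌊x⌋₊ ≠ 0 := (Nat.floor_pos.mpr hx).ne'
  have h2 := abs_sum_liouvilleAP_two_two_sub_le ⌊x⌋₊
  have h3 : (Nat.log 2 ⌊x⌋₊ : ℝ) ≤ 1 / Real.log 2 * Real.log x := by
    have := Real.natLog_le_logb ⌊x⌋₊ 2
    rw [Real.logb, Nat.cast_ofNat] at this
    rw [one_div_mul_eq_div]
    refine this.trans ?_
    gcongr
    exact Nat.floor_le (by linarith)
  have h4 := Nat.floor_le (by linarith : 0 ≤ x)
  have h5 := Nat.lt_floor_add_one x
  have h6 : 0 ≤ 1 / Real.log 2 * Real.log x := le_trans (by positivity) h3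
  rw [one_mul, Real.norm_eq_abs, Real.norm_of_nonneg (by linarith)]
  unfold sumLiouvilleAP
  rw [abs_le] at h2 ⊢
  constructor <;> linarith

/-- The completely multiplicative function `n ↦ λ(n; 2, 1) n ^ (-s)`. -/
noncomputable def liouvilleSummandHom {s : ℂ} (hs : s ≠ 0) : ℕ →*₀ ℂ where
  toFun n := liouvilleAP n 2 1 * (n : ℂ) ^ (-s)
  map_zero' := by simp [hs]
  map_one' := by simp
  map_mul' m n := by
    rcases eq_or_ne m 0 with rfl | hm
    · simp [hs]
    rcases eq_or_ne n 0 with rfl | hn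
    · simp [hs]
    rw [liouvilleAP_mul hm hn, Nat.cast_mul, Complex.natCast_mul_natCast_cpow]
    push_cast
    ring

lemma liouvilleSummandHom_apply {s : ℂ} (hs : s ≠ 0) (n : ℕ) :
    liouvilleSummandHom hs n = liouvilleAP n 2 1 * (n : ℂ) ^ (-s) := rfl

/-- An explicit meromorphic continuation of the Dirichlet series of `λ(·; 2, 1)`. -/
noncomputable def liouvilleSeries (s : ℂ) : ℂ :=
  riemannZeta (2 * s) * (1 + 2 ^ (-s)) / (1 - 2 ^ (-s)) * ((s - 1) / riemannZeta₁ s)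

lemma norm_two_cpow_neg_lt_one {s : ℂ} (hs : 0 < s.re) : ‖(2 : ℂ) ^ (-s)‖ < 1 := by
  have := Complex.norm_natCast_cpow_of_pos (n := 2) two_pos (-s)
  rw [Nat.cast_ofNat] at this
  rw [this, Complex.neg_re]
  exact Real.rpow_lt_one_of_one_lt_of_neg (by norm_num) (by linarith)

lemma hasProd_liouvilleAP {s : ℂ} (hs : 1 < s.re) :
    HasProd (fun p : Nat.Primes ↦ (1 - liouvilleAP p 2 1 * (p : ℂ) ^ (-s))⁻¹)
      (LSeries (fun n ↦ (liouvilleAP n 2 1 : ℂ)) s) := by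
  have hs0 : s ≠ 0 := Complex.ne_zero_of_one_lt_re hs
  have hsum : Summable (fun n ↦ ‖liouvilleSummandHom hs0 n‖) := by
    refine (summable_riemannZetaSummand hs).congr fun n ↦ ?_
    have h : ‖(liouvilleAP n 2 1 : ℂ)‖ = 1 := norm_liouvilleAP n 2 1
    rw [liouvilleSummandHom_apply, norm_mul, h, one_mul]
    rfl
  have hL : LSeries (fun n ↦ (liouvilleAP n 2 1 : ℂ)) s = ∑' n, liouvilleSummandHom hs0 n := by
    refine tsum_congr fun n ↦ ?_
    rw [LSeries.term_of_ne_zero' hs0, div_eq_mul_inv, ← Complex.cpow_neg,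
      liouvilleSummandHom_apply]
  rw [hL]
  simpa only [liouvilleSummandHom_apply] using
    EulerProduct.eulerProduct_completely_multiplicative_hasProd hsum

/-- Multiply by `ζ(s)` and compare local factors. At an odd prime, `(1 + p^(-s))⁻¹ (1 - p^(-s))⁻¹ =
(1 - p^(-2s))⁻¹`, the factor of `ζ(2s)`; at 2 the product is `(1 - 2^(-s))⁻²`, which accounts for
the extra quotient. -/
lemma LSeries_liouvilleAP_eq {s : ℂ} (hs : 1 < s.re) :
    LSeries (fun n ↦ (liouvilleAP n 2 1 : ℂ)) s = liouvilleSeries s := by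
  have hs1 : s ≠ 1 := by rintro rfl; simp at hs
  have h2s : 1 < (2 * s).re := by simp; linarith
  have hlt := norm_two_cpow_neg_lt_one (s := s) (by linarith)
  have hne1 : (1 : ℂ) - 2 ^ (-s) ≠ 0 := by
    intro h
    rw [sub_eq_zero] at h
    rw [← h] at hlt; simp at hlt
  have hne2 : (1 : ℂ) + 2 ^ (-s) ≠ 0 := by
    intro h
    rw [add_comm, add_eq_zero_iff_eq_neg] at h
    rw [h] at hlt; simp at hlt
  let p₂ : Nat.Primes := ⟨2, Nat.prime_two⟩
  classical
  have hA := (hasProd_liouvilleAP hs).mul (riemannZeta_eulerProduct_hasProd hs)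
  -- The correction at 2 is written as a product over all primes with one nontrivial factor, so that
  -- uniqueness of infinite products applies.
  have hB := (riemannZeta_eulerProduct_hasProd h2s).mul
    (hasProd_ite_eq p₂ ((1 + (2 : ℂ) ^ (-s)) / (1 - 2 ^ (-s))))
  have hsq (p : ℕ) : (p : ℂ) ^ (-(2 * s)) = (p : ℂ) ^ (-s) * (p : ℂ) ^ (-s) := by
    rw [show -(2 * s) = (2 : ℕ) * (-s) by push_cast; ring, Complex.cpow_nat_mul, sq]
  have hfactor (p : Nat.Primes) :
      (1 - liouvilleAP p 2 1 * (p : ℂ) ^ (-s))⁻¹ * (1 - (p : ℂ) ^ (-s))⁻¹ =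
        (1 - (p : ℂ) ^ (-(2 * s)))⁻¹ *
          if p = p₂ then (1 + (2 : ℂ) ^ (-s)) / (1 - 2 ^ (-s)) else 1 := by
    rw [hsq, liouvilleAP_prime p.2]
    split_ifs with h1 h2 h2
    · simp [h2, p₂, Nat.ModEq] at h1
    · rw [mul_one, ← mul_inv]
      push_cast
      ring
    · rw [h2]
      simp only [p₂, Int.cast_one, one_mul, Nat.cast_ofNat]
      rw [show (1 : ℂ) - 2 ^ (-s) * 2 ^ (-s) = (1 - 2 ^ (-s)) * (1 + 2 ^ (-s)) by ring]
      field_simp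
    · exact absurd (Nat.odd_iff.mp (p.2.odd_of_ne_two fun h ↦ h2 (Subtype.ext h))) h1
  have heq := hA.unique (by simpa only [hfactor] using hB)
  have hz : riemannZeta s ≠ 0 := riemannZeta_ne_zero_of_one_lt_re hs
  have hz1 : riemannZeta₁ s = (s - 1) * riemannZeta s := by
    rw [riemannZeta_eq_inv_sub_mul hs1, mul_inv_cancel_left₀ (sub_ne_zero.mpr hs1)]
  have hs1' := sub_ne_zero.mpr hs1
  rw [liouvilleSeries, hz1, eq_comm, div_mul_cancel_left₀ hs1', mul_comm, inv_mul_eq_div,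
    div_eq_iff hz, heq, mul_div_assoc]

end

/-! ### Growth and nonvanishing of `riemannZeta₁`. -/

section

open Filter Asymptotics Topology

lemma norm_LSeries_le_of_norm_le_one {f : ℕ → ℂ} (hf : ∀ n, ‖f n‖ ≤ 1) {σ : ℝ} (hσ : 1 < σ)
    {s : ℂ} (hs : σ ≤ s.re) : ‖LSeries f s‖ ≤ ∑' n : ℕ, 1 / (n : ℝ) ^ σ := by
  refine tsum_of_norm_bounded (Real.summable_one_div_nat_rpow.mpr hσ).hasSum fun n ↦ ?_
  rcases eq_or_ne n 0 with rfl | hn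
  · simp; positivity
  rw [LSeries.norm_term_eq, if_neg hn]
  have hn1 : (1 : ℝ) ≤ n := by exact_mod_cast Nat.one_le_iff_ne_zero.mpr hn
  gcongr
  exact hf n

/-- The function `t ↦ t - ⌊t⌋` on `(1, ∞)`, extended by zero. -/
noncomputable def fractAboveOne : ℝ → ℂ :=
  Set.indicator (Set.Ioi 1) fun t ↦ ((t - ⌊t⌋₊ : ℝ) : ℂ)

lemma norm_fractAboveOne_le (t : ℝ) : ‖fractAboveOne t‖ ≤ 1 := by
  unfold fractAboveOne
  by_cases h : t ∈ Set.Ioi (1 : ℝ)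
  · rw [Set.indicator_of_mem h, Complex.norm_real, Real.norm_eq_abs, abs_le]
    have h1 := Nat.floor_le (zero_le_one.trans (le_of_lt (Set.mem_Ioi.mp h)))
    have h2 := Nat.lt_floor_add_one t
    constructor <;> linarith
  · simp [Set.indicator_of_notMem h]

lemma measurable_fractAboveOne : Measurable fractAboveOne := by
  unfold fractAboveOne
  refine Measurable.indicator ?_ measurableSet_Ioi
  fun_prop

/-- The function is bounded and vanishes near 0, so only its behaviour at infinity restricts the
half plane. -/
lemma differentiableAt_mellin_fractAboveOne {s : ℂ} (hs : s.re < 0) :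
    DifferentiableAt ℂ (mellin fractAboveOne) s := by
  refine mellin_differentiableAt_of_isBigO_rpow (a := 0) (b := s.re - 1) ?_ ?_ hs ?_ (by linarith)
  · refine MeasureTheory.LocallyIntegrable.locallyIntegrableOn ?_ _
    refine (MeasureTheory.locallyIntegrable_const (1 : ℝ)).mono
      measurable_fractAboveOne.aestronglyMeasurable (MeasureTheory.ae_of_all _ fun t ↦ ?_)
    simpa using norm_fractAboveOne_le t
  · refine IsBigO.of_bound 1 (Eventually.of_forall fun t ↦ ?_)
    simpa using norm_fractAboveOne_le t
  · refine IsBigO.of_bound 1 ?_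
    filter_upwards [Ioo_mem_nhdsGT (zero_lt_one (α := ℝ))] with t ht
    rw [fractAboveOne, Set.indicator_of_notMem (by simpa using ht.2.le)]
    simp

lemma mellin_fractAboveOne_neg (s : ℂ) : mellin fractAboveOne (-s) =
    ∫ t in Set.Ioi (1 : ℝ), (t : ℂ) ^ (-s - 1) * ((t - ⌊t⌋₊ : ℝ) : ℂ) := by
  rw [mellin, ← MeasureTheory.integral_indicator measurableSet_Ioi,
    ← MeasureTheory.integral_indicator measurableSet_Ioi]
  congr 1 with t
  by_cases h : 1 < t
  · simp [fractAboveOne, Set.indicator, h, zero_lt_one.trans h]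
  · simp [fractAboveOne, Set.indicator, h]

lemma norm_mellin_fractAboveOne_neg_le {s : ℂ} (hs : 0 < s.re) :
    ‖mellin fractAboveOne (-s)‖ ≤ 1 / s.re := by
  have h2 : ∫ t in Set.Ioi (1 : ℝ), t ^ (-s.re - 1) = 1 / s.re := by
    rw [integral_Ioi_rpow_of_lt (by linarith) one_pos]
    simp
  rw [mellin_fractAboveOne_neg, ← h2]
  refine MeasureTheory.norm_integral_le_of_norm_le
    (integrableOn_Ioi_rpow_of_lt (by linarith) one_pos) ?_
  refine MeasureTheory.ae_restrict_of_forall_mem measurableSet_Ioi fun t ht ↦ ?_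
  have ht0 : (0 : ℝ) < t := zero_lt_one.trans ht
  have h3 := norm_fractAboveOne_le t
  rw [fractAboveOne, Set.indicator_of_mem ht] at h3
  rw [norm_mul, Complex.norm_cpow_eq_rpow_re_of_pos ht0]
  simpa using mul_le_of_le_one_right (by positivity) h3

/-- Partial summation gives `ζ(s) = s ∫ ⌊t⌋ t^(-s-1) dt` over `t > 1`; splitting `⌊t⌋ = t - {t}`
isolates the pole in an explicit term. -/
lemma riemannZeta₁_eq_of_one_lt_re {s : ℂ} (hs : 1 < s.re) :
    riemannZeta₁ s = s - s * (s - 1) * mellin fractAboveOne (-s) := by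
  have hs1 : s ≠ 1 := by rintro rfl; simp at hs
  have hs1' := sub_ne_zero.mpr hs1
  have hz1 : riemannZeta₁ s = (s - 1) * riemannZeta s := by
    rw [riemannZeta_eq_inv_sub_mul hs1, mul_inv_cancel_left₀ hs1']
  have h := LSeries_eq_mul_integral' (1 : ℕ → ℂ) (r := 1) zero_le_one hs
    (by simpa using isBigO_refl _ _)
  rw [LSeries_one_eq_riemannZeta hs] at h
  have hint1 : MeasureTheory.IntegrableOn (fun t : ℝ ↦ (t : ℂ) ^ (-s)) (Set.Ioi 1) :=
    integrableOn_Ioi_cpow_of_lt (by simpa using hs) one_pos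
  have hint2 : MeasureTheory.IntegrableOn
      (fun t : ℝ ↦ (t : ℂ) ^ (-s - 1) * ((t - ⌊t⌋₊ : ℝ) : ℂ)) (Set.Ioi 1) := by
    have h0 : MeasureTheory.IntegrableOn (fun t : ℝ ↦ (t : ℂ) ^ (-s - 1)) (Set.Ioi 1) :=
      integrableOn_Ioi_cpow_of_lt (by simp; linarith) one_pos
    refine MeasureTheory.Integrable.mul_bdd (c := 1) h0 (Measurable.aestronglyMeasurable (by fun_prop)) ?_
    refine MeasureTheory.ae_restrict_of_forall_mem measurableSet_Ioi fun t ht ↦ ?_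
    have h3 := norm_fractAboveOne_le t
    rwa [fractAboveOne, Set.indicator_of_mem ht] at h3
  have h2 : riemannZeta s = s * (1 / (s - 1) - mellin fractAboveOne (-s)) := by
    rw [h, mellin_fractAboveOne_neg]
    have h3 : ∫ t in Set.Ioi (1 : ℝ), (t : ℂ) ^ (-s) = 1 / (s - 1) := by
      rw [integral_Ioi_cpow_of_lt (by simpa using hs) one_pos]
      rw [Complex.ofReal_one, Complex.one_cpow, ← neg_sub, neg_div, ← div_neg]
      congr 1
      ring
    rw [← h3, ← MeasureTheory.integral_sub hint1 hint2]
    congr 1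
    refine MeasureTheory.setIntegral_congr_fun measurableSet_Ioi fun t ht ↦ ?_
    have ht0 : (t : ℂ) ≠ 0 := by
      exact_mod_cast (zero_lt_one.trans (Set.mem_Ioi.mp ht)).ne'
    have h4 : (t : ℂ) ^ (-s) = (t : ℂ) ^ (-s - 1) * t := by
      rw [Complex.cpow_sub _ _ ht0, Complex.cpow_one, div_mul_cancel₀ _ ht0]
    simp only [Pi.one_apply, Finset.sum_const, Nat.card_Icc, add_tsub_cancel_right, nsmul_eq_mul,
      mul_one]
    rw [h4, neg_add']
    push_cast
    ring
  rw [hz1, h2]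
  field_simp

/-- Both sides are holomorphic on `Re s > 0`, so the identity theorem extends the formula from `Re s
> 1`. It yields the polynomial growth bound inside the critical strip. -/
lemma riemannZeta₁_eq_of_re_pos {s : ℂ} (hs : 0 < s.re) :
    riemannZeta₁ s = s - s * (s - 1) * mellin fractAboveOne (-s) := by
  have hopen : IsOpen {z : ℂ | 0 < z.re} := isOpen_lt continuous_const Complex.continuous_re
  have hconv : Convex ℝ {z : ℂ | 0 < z.re} := convex_halfSpace_re_gt 0
  refine AnalyticOnNhd.eqOn_of_preconnected_of_eventuallyEq (𝕜 := ℂ)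
    (U := {z : ℂ | 0 < z.re})
    (f := riemannZeta₁) (g := fun s ↦ s - s * (s - 1) * mellin fractAboveOne (-s)) (z₀ := 2)
    ?_ ?_ hconv.isPreconnected (by simp) ?_ hs
  · exact differentiable_riemannZeta₁.differentiableOn.analyticOnNhd hopen
  · refine DifferentiableOn.analyticOnNhd (fun z hz ↦ ?_) hopen
    have h1 : DifferentiableAt ℂ (fun z ↦ mellin fractAboveOne (-z)) z :=
      (differentiableAt_mellin_fractAboveOne (s := -z) (by simpa using hz)).comp z
        differentiableAt_id.neg
    exact (DifferentiableAt.sub (by fun_prop) (DifferentiableAt.mul (by fun_prop) h1)).differentiableWithinAt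
  · filter_upwards [(isOpen_lt continuous_const Complex.continuous_re).mem_nhds
      (show (1 : ℝ) < (2 : ℂ).re by simp)] with z hz
    exact riemannZeta₁_eq_of_one_lt_re hz

lemma norm_riemannZeta₁_le {s : ℂ} (hs : 0 < s.re) :
    ‖riemannZeta₁ s‖ ≤ ‖s‖ * (1 + ‖s - 1‖ / s.re) := by
  have h := norm_mellin_fractAboveOne_neg_le hs
  calc ‖riemannZeta₁ s‖ = ‖s - s * (s - 1) * mellin fractAboveOne (-s)‖ := by
        rw [riemannZeta₁_eq_of_re_pos hs]
    _ ≤ ‖s‖ + ‖s‖ * ‖s - 1‖ * (1 / s.re) := by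
        refine (norm_sub_le _ _).trans ?_
        rw [norm_mul, norm_mul]
        gcongr
    _ = _ := by ring

lemma riemannZeta₁_eq_sub_one_mul {s : ℂ} (hs : s ≠ 1) :
    riemannZeta₁ s = (s - 1) * riemannZeta s := by
  rw [riemannZeta_eq_inv_sub_mul hs, mul_inv_cancel_left₀ (sub_ne_zero.mpr hs)]

lemma riemannZeta₁_ne_zero_of_one_le_re {s : ℂ} (hs : 1 ≤ s.re) : riemannZeta₁ s ≠ 0 := by
  rcases eq_or_ne s 1 with rfl | h1
  · simp
  rw [riemannZeta₁_eq_sub_one_mul h1]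
  exact mul_ne_zero (sub_ne_zero.mpr h1) (riemannZeta_ne_zero_of_one_le_re hs)

lemma riemannZeta₁_ne_zero_of_riemannHypothesis (RH : RiemannHypothesis) {s : ℂ}
    (hs : 1 / 2 < s.re) : riemannZeta₁ s ≠ 0 := by
  rcases eq_or_ne s 1 with rfl | h1
  · simp
  rw [riemannZeta₁_eq_sub_one_mul h1]
  refine mul_ne_zero (sub_ne_zero.mpr h1) fun h0 ↦ hs.ne' (RH s h0 ?_ h1)
  rintro ⟨n, rfl⟩
  have : (-2 * ((n : ℂ) + 1)).re = -2 * ((n : ℝ) + 1) := by simp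
  rw [this] at hs
  have : (0 : ℝ) ≤ n := n.cast_nonneg
  linarith

end

/-! ### Littlewood's bound for `1/ζ` under the Riemann hypothesis. -/

section

open Filter Asymptotics Topology

open Complex.HadamardThreeLines in
/-- Hadamard's three circles theorem. -/
lemma norm_le_interp_of_three_circles {f : ℂ → ℂ} {c z : ℂ} {r₁ r₂ R a b : ℝ} (hr₁ : 0 < r₁)
    (hr : r₁ < r₂) (hR : r₂ < R) (hf : DifferentiableOn ℂ f (Metric.ball c R))
    (ha : ∀ w, ‖w - c‖ = r₁ → ‖f w‖ ≤ a) (hb : ∀ w, ‖w - c‖ = r₂ → ‖f w‖ ≤ b)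
    (hz₁ : r₁ ≤ ‖z - c‖) (hz₂ : ‖z - c‖ ≤ r₂) :
    ‖f z‖ ≤ a ^ (1 - Real.log (‖z - c‖ / r₁) / Real.log (r₂ / r₁)) *
      b ^ (Real.log (‖z - c‖ / r₁) / Real.log (r₂ / r₁)) := by
  have hr₂ : 0 < r₂ := hr₁.trans hr
  have hz0 : 0 < ‖z - c‖ := hr₁.trans_le hz₁
  have hzc : z - c ≠ 0 := norm_pos_iff.mp hz0
  have hnorm (w : ℂ) : ‖c + Complex.exp w - c‖ = Real.exp w.re := by
    rw [add_sub_cancel_left, Complex.norm_exp]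
  have hmem {w : ℂ} (hw : w.re ≤ Real.log r₂) :
      c + Complex.exp w ∈ Metric.closedBall c r₂ := by
    rw [mem_closedBall_iff_norm, hnorm]
    exact (Real.le_log_iff_exp_le hr₂).mp hw
  have hmaps : Set.MapsTo (fun w ↦ c + Complex.exp w) {w : ℂ | w.re ≤ Real.log r₂}
      (Metric.ball c R) := fun w hw ↦
    Metric.closedBall_subset_ball hR (hmem hw)
  have hd : DifferentiableOn ℂ (fun w ↦ f (c + Complex.exp w)) {w : ℂ | w.re ≤ Real.log r₂} :=
    hf.comp (by fun_prop) hmaps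
  have hcl : closure (verticalStrip (Real.log r₁) (Real.log r₂)) ⊆
      {w : ℂ | w.re ≤ Real.log r₂} :=
    closure_minimal (fun w hw ↦ le_of_lt hw.2)
      (isClosed_le Complex.continuous_re continuous_const)
  -- The substitution `c + exp w` turns circles of radius `r` into the lines `Re w = log r`,
  -- reducing the claim to the three lines theorem.
  have key := norm_le_interp_of_mem_verticalClosedStrip' (f := fun w ↦ f (c + Complex.exp w))
    (z := Complex.log (z - c)) (a := a) (b := b) (Real.log_lt_log hr₁ hr) ?_
    (hd.mono hcl).diffContOnCl ?_ ?_ ?_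
  · rw [Complex.exp_log hzc, add_sub_cancel, Complex.log_re, ← Real.log_div hz0.ne' hr₁.ne',
      ← Real.log_div hr₂.ne' hr₁.ne'] at key
    exact key
  · rw [verticalClosedStrip, Set.mem_preimage, Complex.log_re]
    exact ⟨Real.log_le_log hr₁ hz₁, Real.log_le_log hz0 hz₂⟩
  · have hcomp : IsCompact (f '' Metric.closedBall c r₂) :=
      (isCompact_closedBall c r₂).image_of_continuousOn
        (hf.continuousOn.mono (Metric.closedBall_subset_ball hR))
    obtain ⟨B, hB⟩ := hcomp.isBounded.exists_norm_le
    refine ⟨B, ?_⟩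
    rintro _ ⟨w, hw, rfl⟩
    exact hB _ ⟨_, hmem hw.2, rfl⟩
  · intro w hw
    refine ha _ ?_
    rw [hnorm, show w.re = Real.log r₁ from hw, Real.exp_log hr₁]
  · intro w hw
    refine hb _ ?_
    rw [hnorm, show w.re = Real.log r₂ from hw, Real.exp_log hr₂]

/-- A nonvanishing holomorphic function on a ball has a holomorphic logarithm. -/
lemma exists_log_of_differentiableOn_ball {Q : ℂ → ℂ} {c : ℂ} {R : ℝ} (hR : 0 < R)
    (hQ : DifferentiableOn ℂ Q (Metric.ball c R)) (hQ0 : ∀ z ∈ Metric.ball c R, Q z ≠ 0) :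
    ∃ f : ℂ → ℂ, DifferentiableOn ℂ f (Metric.ball c R) ∧ f c = Complex.log (Q c) ∧
      ∀ z ∈ Metric.ball c R, Complex.exp (f z) = Q z := by
  have hc : c ∈ Metric.ball c R := Metric.mem_ball_self hR
  have hQ' : DifferentiableOn ℂ (deriv Q) (Metric.ball c R) := hQ.deriv Metric.isOpen_ball
  obtain ⟨f, hfc, hf⟩ := ((hQ'.div hQ hQ0).isExactOn_ball).with_val_at c (Complex.log (Q c))
  refine ⟨f, fun z hz ↦ (hf z hz).differentiableAt.differentiableWithinAt, hfc, fun z hz ↦ ?_⟩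
  -- For a primitive `f` of `Q'/Q` the function `Q exp(-f)` has zero derivative; the normalisation
  -- at `c` makes its constant value 1.
  have hderiv (w) (hw : w ∈ Metric.ball c R) :
      HasDerivAt (fun w ↦ Q w * Complex.exp (-f w)) 0 w := by
    have h1 : HasDerivAt Q (deriv Q w) w :=
      (hQ.differentiableAt (Metric.isOpen_ball.mem_nhds hw)).hasDerivAt
    refine (h1.fun_mul (hf w hw).fun_neg.cexp).congr_deriv ?_
    have := hQ0 w hw
    rw [Pi.div_apply]
    field_simp
    ring
  have hconst := (convex_ball c R).is_const_of_fderivWithin_eq_zero (𝕜 := ℂ)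
    (f := fun w ↦ Q w * Complex.exp (-f w))
    (fun w hw ↦ (hderiv w hw).differentiableAt.differentiableWithinAt)
    (fun w hw ↦ by
      rw [fderivWithin_of_isOpen Metric.isOpen_ball hw]
      ext
      simp [(hderiv w hw).deriv]) hz hc
  simp only [hfc, Complex.exp_neg, Complex.exp_log (hQ0 c hc)] at hconst
  rw [mul_inv_cancel₀ (hQ0 c hc)] at hconst
  exact (eq_of_mul_inv_eq_one hconst).symm

/-- Borel-Carathéodory on a ball with arbitrary centre. -/
lemma norm_le_of_re_le_on_ball {f : ℂ → ℂ} {c z : ℂ} {r R M : ℝ} (hM : 0 < M) (hr : 0 ≤ r)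
    (hrR : r < R) (hf : DifferentiableOn ℂ f (Metric.ball c R))
    (hre : ∀ w ∈ Metric.ball c R, (f w).re ≤ M) (hz : ‖z - c‖ ≤ r) :
    ‖f z‖ ≤ 2 * R / (R - r) * (M + ‖f c‖) := by
  have hR : 0 < R := hr.trans_lt hrR
  have hmaps : Set.MapsTo (fun w ↦ c + w) (Metric.ball 0 R) (Metric.ball c R) := fun w hw ↦ by
    simpa using hw
  have h := Complex.borelCaratheodory (f := fun w ↦ f (c + w)) (z := z - c) (R := R) hM
    (hf.comp (by fun_prop) hmaps) (fun w hw ↦ hre _ (hmaps hw)) hR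
    (by simpa using hz.trans_lt hrR)
  simp only [add_sub_cancel, add_zero] at h
  refine h.trans ?_
  have h1 : 0 < R - r := by linarith
  have h2 : 2 * M * ‖z - c‖ / (R - ‖z - c‖) ≤ 2 * M * R / (R - r) := by
    gcongr
    linarith
  have h3 : ‖f c‖ * (R + ‖z - c‖) / (R - ‖z - c‖) ≤ ‖f c‖ * (2 * R) / (R - r) := by
    gcongr
    linarith
  calc _ ≤ 2 * M * R / (R - r) + ‖f c‖ * (2 * R) / (R - r) := add_le_add h2 h3
    _ = _ := by ring

/-- If a nonvanishing holomorphic function on a ball is at most `exp M`, and has bounded logarithm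
near the centre, then its inverse on smaller balls is at most `exp (C * M ^ θ)` with `θ < 1`. -/
lemma exists_norm_inv_le_exp_rpow {δ B : ℝ} (hδ : 0 < δ) (hδ' : δ < 1 / 4) (hB : 0 < B) :
    ∃ C θ : ℝ, 0 < C ∧ 0 < θ ∧ θ < 1 ∧ ∀ (Q : ℂ → ℂ) (c : ℂ) (M : ℝ), 1 ≤ M →
      DifferentiableOn ℂ Q (Metric.ball c (3 / 2)) → (∀ z ∈ Metric.ball c (3 / 2), Q z ≠ 0) →
      (∀ z ∈ Metric.ball c (3 / 2), ‖Q z‖ ≤ Real.exp M) →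
      (∀ z ∈ Metric.ball c (1 - δ / 2), ‖Q z‖ ≤ Real.exp B) → ‖Complex.log (Q c)‖ ≤ B →
      ∀ z, ‖z - c‖ ≤ 3 / 2 - 2 * δ → ‖(Q z)⁻¹‖ ≤ Real.exp (C * M ^ θ) := by
  -- `a` and `D * M` are the Borel–Carathéodory bounds for `log Q` at radii `1 - δ` and `3/2 - δ`,
  -- and `θ` is the three circles exponent of the intermediate radius `3/2 - 2δ`. The added 1 makes
  -- `a ≥ 1`, so that powers of `a` with exponent at most 1 are bounded by `a`.
  set a : ℝ := 2 * (1 - δ / 2) / (1 - δ / 2 - (1 - δ)) * (B + B) + 1 with ha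
  set D : ℝ := 2 * (3 / 2) / (3 / 2 - (3 / 2 - δ)) * (1 + B) with hD
  set θ : ℝ := Real.log ((3 / 2 - 2 * δ) / (1 - δ)) / Real.log ((3 / 2 - δ) / (1 - δ)) with hθ
  have hr1 : 0 < 1 - δ := by linarith
  have hl : 0 < Real.log ((3 / 2 - δ) / (1 - δ)) :=
    Real.log_pos ((one_lt_div hr1).mpr (by linarith))
  have hl' : 0 < Real.log ((3 / 2 - 2 * δ) / (1 - δ)) :=
    Real.log_pos ((one_lt_div hr1).mpr (by linarith))
  have hθ0 : 0 < θ := div_pos hl' hl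
  have hθ1 : θ < 1 := by
    rw [hθ, div_lt_one hl]
    refine Real.log_lt_log (div_pos (by linarith) hr1) ?_
    gcongr
    linarith
  have ha1 : 1 ≤ a := by
    have : 0 ≤ 2 * (1 - δ / 2) / (1 - δ / 2 - (1 - δ)) * (B + B) :=
      mul_nonneg (div_nonneg (by linarith) (by linarith)) (by linarith)
    linarith
  have hD1 : 1 ≤ D := by
    have : 1 ≤ 2 * (3 / 2) / (3 / 2 - (3 / 2 - δ)) := by
      rw [one_le_div (by linarith)]
      linarith
    nlinarith
  refine ⟨a * D ^ θ, θ, by positivity, hθ0, hθ1, fun Q c M hM hQ hQ0 hQM hQB hQc z hz ↦ ?_⟩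
  obtain ⟨f, hf, hfc, hfQ⟩ := exists_log_of_differentiableOn_ball (by norm_num) hQ hQ0
  have hre (w) (hw : w ∈ Metric.ball c (3 / 2)) {M' : ℝ} (h : ‖Q w‖ ≤ Real.exp M') :
      (f w).re ≤ M' := by
    rwa [← hfQ w hw, Complex.norm_exp, Real.exp_le_exp] at h
  have hsub : Metric.ball c (1 - δ / 2) ⊆ Metric.ball c (3 / 2) :=
    Metric.ball_subset_ball (by linarith)
  have hinner (w : ℂ) (hw : ‖w - c‖ ≤ 1 - δ) : ‖f w‖ ≤ a := by
    have := norm_le_of_re_le_on_ball (R := 1 - δ / 2) hB hr1.le (by linarith) (hf.mono hsub)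
      (fun w hw ↦ hre w (hsub hw) (hQB w hw)) hw
    refine this.trans ?_
    rw [ha, hfc]
    refine le_add_of_le_of_nonneg ?_ zero_le_one
    refine mul_le_mul_of_nonneg_left (by linarith) (div_nonneg (by linarith) (by linarith))
  have houter (w : ℂ) (hw : ‖w - c‖ ≤ 3 / 2 - δ) : ‖f w‖ ≤ D * M := by
    have := norm_le_of_re_le_on_ball (R := 3 / 2) (M := M) (by linarith) (by linarith)
      (by linarith) hf (fun w hw ↦ hre w hw (hQM w hw)) hw
    refine this.trans ?_
    rw [hD, hfc, mul_assoc _ (1 + B)]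
    refine mul_le_mul_of_nonneg_left (by nlinarith) (div_nonneg (by linarith) (by linarith))
  have hDM : 1 ≤ D * M := one_le_mul_of_one_le_of_one_le hD1 hM
  have hfz : ‖f z‖ ≤ a * (D * M) ^ θ := by
    rcases le_total ‖z - c‖ (1 - δ) with h | h
    · refine (hinner z h).trans (le_mul_of_one_le_right (by linarith) ?_)
      exact Real.one_le_rpow hDM hθ0.le
    have h3 := norm_le_interp_of_three_circles (a := a) (b := D * M) (R := 3 / 2) hr1
      (by linarith : 1 - δ < 3 / 2 - δ) (by linarith) hf (fun w hw ↦ hinner w hw.le)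
      (fun w hw ↦ houter w hw.le) h (by linarith)
    refine h3.trans ?_
    have hz0 : 0 ≤ Real.log (‖z - c‖ / (1 - δ)) / Real.log ((3 / 2 - δ) / (1 - δ)) :=
      div_nonneg (Real.log_nonneg ((one_le_div hr1).mpr h)) hl.le
    have hzθ : Real.log (‖z - c‖ / (1 - δ)) / Real.log ((3 / 2 - δ) / (1 - δ)) ≤ θ := by
      rw [hθ]
      have : 0 < ‖z - c‖ / (1 - δ) := div_pos (by linarith) hr1
      gcongr
    refine mul_le_mul ?_ (Real.rpow_le_rpow_of_exponent_le hDM hzθ) (by positivity) (by linarith)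
    exact (Real.rpow_le_rpow_of_exponent_le ha1 (by linarith)).trans_eq (Real.rpow_one a)
  have hzb : z ∈ Metric.ball c (3 / 2) := by
    rw [mem_ball_iff_norm]
    linarith
  rw [← hfQ z hzb, ← Complex.exp_neg, Complex.norm_exp, Real.exp_le_exp]
  calc (-f z).re ≤ ‖-f z‖ := Complex.re_le_norm _
    _ = ‖f z‖ := norm_neg _
    _ ≤ _ := hfz
    _ = _ := by rw [Real.mul_rpow (by linarith) (by linarith), mul_assoc]

/-- With `M` the logarithm of the height, this converts a bound `exp (C * M ^ θ)` into an
arbitrarily small power of the height. -/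
lemma exists_mul_rpow_le_mul_add {C θ η : ℝ} (hC : 0 < C) (hθ : 0 < θ) (hθ' : θ < 1)
    (hη : 0 < η) : ∃ K : ℝ, ∀ M : ℝ, 1 ≤ M → C * M ^ θ ≤ η * M + K := by
  obtain ⟨M₀, hM₀⟩ := eventually_atTop.mp
    ((tendsto_rpow_atTop (sub_pos.mpr hθ')).eventually_ge_atTop (C / η))
  refine ⟨C * |M₀| ^ θ, fun M hM ↦ ?_⟩
  rcases le_total M₀ M with h1 | h1
  · have h2 := hM₀ M h1
    rw [div_le_iff₀ hη] at h2
    have h3 : M ^ (1 - θ) * M ^ θ = M := by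
      rw [← Real.rpow_add (by linarith), sub_add_cancel, Real.rpow_one]
    have h4 : 0 < M ^ θ := by positivity
    have h5 : C * M ^ θ ≤ η * M := by
      calc C * M ^ θ ≤ M ^ (1 - θ) * η * M ^ θ := by gcongr
        _ = η * (M ^ (1 - θ) * M ^ θ) := by ring
        _ = η * M := by rw [h3]
    have : 0 ≤ C * |M₀| ^ θ := by positivity
    linarith
  · have : M ^ θ ≤ |M₀| ^ θ :=
      Real.rpow_le_rpow (by linarith) (h1.trans (le_abs_self _)) hθ.le
    have : 0 ≤ η * M := by positivity
    nlinarith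

/-- Dividing by `s + 1` instead of `s - 1` keeps the size of `ζ` at large height without
reintroducing the pole. -/
lemma norm_riemannZeta₁_div_le {s : ℂ} (hs : 1 / 2 < s.re) :
    ‖riemannZeta₁ s / (s + 1)‖ ≤ 1 + 2 * ‖s - 1‖ := by
  have h0 : ‖s‖ ≤ ‖s + 1‖ := by
    rw [← sq_le_sq₀ (norm_nonneg _) (norm_nonneg _), Complex.sq_norm, Complex.sq_norm,
      Complex.normSq_apply, Complex.normSq_apply]
    simp
    nlinarith
  have h1 : 0 < ‖s + 1‖ := by
    refine lt_of_lt_of_le (norm_pos_iff.mpr ?_) h0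
    rintro rfl
    norm_num at hs
  rw [norm_div, div_le_iff₀ h1]
  have h2 : ‖s - 1‖ / s.re ≤ 2 * ‖s - 1‖ := by
    rw [div_le_iff₀ (by linarith)]
    nlinarith [norm_nonneg (s - 1)]
  calc ‖riemannZeta₁ s‖ ≤ ‖s‖ * (1 + ‖s - 1‖ / s.re) := norm_riemannZeta₁_le (by linarith)
    _ ≤ ‖s + 1‖ * (1 + 2 * ‖s - 1‖) := by gcongr
    _ = _ := mul_comm _ _

lemma norm_sub_one_le_norm_add_one {s : ℂ} (hs : 0 ≤ s.re) : ‖s - 1‖ ≤ ‖s + 1‖ := by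
  rw [← sq_le_sq₀ (norm_nonneg _) (norm_nonneg _), Complex.sq_norm, Complex.sq_norm,
    Complex.normSq_apply, Complex.normSq_apply]
  simp
  nlinarith

lemma norm_riemannZeta₁_div_le_tsum {σ : ℝ} (hσ : 1 < σ) {s : ℂ} (hs : σ ≤ s.re) :
    ‖riemannZeta₁ s / (s + 1)‖ ≤ ∑' n : ℕ, 1 / (n : ℝ) ^ σ := by
  have hs1 : s ≠ 1 := by rintro rfl; simp at hs; linarith
  have h1 : 0 < ‖s + 1‖ := by
    refine norm_pos_iff.mpr fun h ↦ ?_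
    have := congrArg Complex.re h
    simp at this
    linarith
  have h2 : ‖riemannZeta s‖ ≤ ∑' n : ℕ, 1 / (n : ℝ) ^ σ := by
    rw [← LSeries_one_eq_riemannZeta (hσ.trans_le hs)]
    exact norm_LSeries_le_of_norm_le_one (by simp) hσ hs
  rw [riemannZeta₁_eq_sub_one_mul hs1, norm_div, norm_mul, div_le_iff₀ h1, mul_comm]
  gcongr
  exact norm_sub_one_le_norm_add_one (by linarith)

/-- On `Re s = 2` the modulus is bounded above by the series for `ζ` and below by the Möbius series
for `1/ζ`, and the imaginary part of the principal logarithm is at most `π` in absolute value. -/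
lemma exists_norm_log_riemannZeta₁_div_le :
    ∃ B : ℝ, ∀ s : ℂ, s.re = 2 → ‖Complex.log (riemannZeta₁ s / (s + 1))‖ ≤ B := by
  set K : ℝ := ∑' n : ℕ, 1 / (n : ℝ) ^ (2 : ℝ) with hK
  refine ⟨|Real.log K| + |Real.log (3 * K)| + Real.pi, fun s hs ↦ ?_⟩
  have hs1 : s ≠ 1 := by rintro rfl; simp at hs
  have hsre : 1 < s.re := by linarith
  have hz0 : riemannZeta s ≠ 0 := riemannZeta_ne_zero_of_one_lt_re hsre
  have hadd : 0 < ‖s + 1‖ := by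
    refine norm_pos_iff.mpr fun h ↦ ?_
    have := congrArg Complex.re h
    simp at this
    linarith
  have hzinv : ‖(riemannZeta s)⁻¹‖ ≤ K := by
    have h := LSeries_one_mul_Lseries_moebius hsre
    rw [LSeries_one_eq_riemannZeta hsre] at h
    rw [inv_eq_of_mul_eq_one_right h]
    refine norm_LSeries_le_of_norm_le_one (fun n ↦ ?_) one_lt_two hs.ge
    rw [Complex.norm_intCast]
    exact_mod_cast ArithmeticFunction.abs_moebius_le_one
  have hK0 : 0 < K := (norm_pos_iff.mpr (inv_ne_zero hz0)).trans_le hzinv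
  have hup : ‖riemannZeta₁ s / (s + 1)‖ ≤ K := norm_riemannZeta₁_div_le_tsum one_lt_two hs.ge
  have hlow : (3 * K)⁻¹ ≤ ‖riemannZeta₁ s / (s + 1)‖ := by
    rw [riemannZeta₁_eq_sub_one_mul hs1, norm_div, norm_mul, mul_inv, le_div_iff₀ hadd]
    have h1 : K⁻¹ ≤ ‖riemannZeta s‖ := by
      rw [inv_le_comm₀ hK0 (norm_pos_iff.mpr hz0), ← norm_inv]
      exact hzinv
    have h2 : ‖s + 1‖ ≤ 3 * ‖s - 1‖ := by
      rw [← sq_le_sq₀ (norm_nonneg _) (by positivity), mul_pow, Complex.sq_norm, Complex.sq_norm,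
        Complex.normSq_apply, Complex.normSq_apply]
      simp [hs]
      nlinarith
    calc 3⁻¹ * K⁻¹ * ‖s + 1‖ ≤ 3⁻¹ * ‖riemannZeta s‖ * (3 * ‖s - 1‖) := by gcongr
      _ = _ := by ring
  have hpos : 0 < ‖riemannZeta₁ s / (s + 1)‖ := lt_of_lt_of_le (by positivity) hlow
  have hlog : |Real.log ‖riemannZeta₁ s / (s + 1)‖| ≤ |Real.log K| + |Real.log (3 * K)| := by
    have h1 := Real.log_le_log hpos hup
    have h2 := Real.log_le_log (by positivity) hlow
    rw [Real.log_inv] at h2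
    rw [abs_le]
    have h3 := le_abs_self (Real.log K)
    have h4 := le_abs_self (Real.log (3 * K))
    have h5 := abs_nonneg (Real.log K)
    have h6 := abs_nonneg (Real.log (3 * K))
    constructor <;> linarith
  refine (Complex.norm_le_abs_re_add_abs_im _).trans ?_
  rw [Complex.log_re, Complex.log_im]
  exact add_le_add hlog (Complex.abs_arg_le_pi _)

/-- Under the Riemann hypothesis, `1 / ζ(s) = O(|t| ^ η)` in `1 / 2 + 2δ ≤ Re s ≤ 2`. -/
lemma exists_norm_add_one_div_riemannZeta₁_le (RH : RiemannHypothesis) {δ η : ℝ} (hδ : 0 < δ)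
    (hδ' : δ < 1 / 4) (hη : 0 < η) :
    ∃ C : ℝ, ∀ s : ℂ, 1 / 2 + 2 * δ ≤ s.re → s.re ≤ 2 →
      ‖(s + 1) / riemannZeta₁ s‖ ≤ C * (1 + |s.im|) ^ η := by
  obtain ⟨B₀, hB₀⟩ := exists_norm_log_riemannZeta₁_div_le
  set K : ℝ := ∑' n : ℕ, 1 / (n : ℝ) ^ (1 + δ / 2) with hK
  set B : ℝ := |B₀| + |Real.log K| + 1 with hB
  have hBpos : 0 < B := by positivity
  obtain ⟨C, θ, hC, hθ, hθ', H⟩ := exists_norm_inv_le_exp_rpow hδ hδ' hBpos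
  obtain ⟨K', hK'⟩ := exists_mul_rpow_le_mul_add hC hθ hθ' hη
  refine ⟨Real.exp K' * 6 ^ η, fun s hs hs' ↦ ?_⟩
  -- Around this centre the ball of radius `3/2` stays in `Re z > 1/2`, where RH excludes zeros, and
  -- the ball of radius `1 - δ/2` stays in `Re z > 1 + δ/2`, where the Dirichlet series bounds `ζ`.
  set c : ℂ := ⟨2, s.im⟩ with hc
  -- On the large ball `1 + 2‖z - 1‖ ≤ 1 + 2(3/2 + 1 + |t|) ≤ 6(1 + |t|)`; as `6 > e`, the logarithm
  -- is at least 1.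
  have h6 : 0 < 6 * (1 + |s.im|) := by positivity
  have hM : 1 ≤ Real.log (6 * (1 + |s.im|)) := by
    rw [Real.le_log_iff_exp_le h6]
    have := Real.exp_one_lt_three
    have := abs_nonneg s.im
    linarith
  have hball {z : ℂ} {r : ℝ} (hz : z ∈ Metric.ball c r) : 2 - r < z.re := by
    rw [mem_ball_iff_norm] at hz
    have h1 := (Complex.abs_re_le_norm (z - c)).trans_lt hz
    rw [abs_lt, Complex.sub_re] at h1
    have : c.re = 2 := rfl
    linarith [h1.1]
  have hadd {z : ℂ} (hz : 0 < z.re) : z + 1 ≠ 0 := fun h ↦ by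
    have := congrArg Complex.re h
    simp at this
    linarith
  have hpos : 0 < K := by
    have h := norm_riemannZeta₁_div_le_tsum (σ := 1 + δ / 2) (by linarith) (s := 2)
      (by simp; linarith)
    refine lt_of_lt_of_le (norm_pos_iff.mpr (div_ne_zero ?_ ?_)) h
    · exact riemannZeta₁_ne_zero_of_one_le_re (by simp)
    · exact hadd (by simp)
  have key := H (fun z ↦ riemannZeta₁ z / (z + 1)) c (Real.log (6 * (1 + |s.im|))) hM ?_ ?_ ?_ ?_ ?_
    s ?_
  · rw [inv_div] at key
    refine key.trans ?_
    calc Real.exp (C * Real.log (6 * (1 + |s.im|)) ^ θ)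
        ≤ Real.exp (η * Real.log (6 * (1 + |s.im|)) + K') := Real.exp_le_exp.mpr (hK' _ hM)
      _ = Real.exp K' * (6 * (1 + |s.im|)) ^ η := by
        rw [Real.exp_add, Real.rpow_def_of_pos h6, mul_comm, mul_comm η]
      _ = _ := by rw [Real.mul_rpow (by norm_num) (by positivity), mul_assoc]
  · intro z hz
    have := hball hz
    exact (differentiable_riemannZeta₁.differentiableAt.div (differentiableAt_id.add_const 1)
      (hadd (z := z) (by linarith))).differentiableWithinAt
  · intro z hz
    have := hball hz
    exact div_ne_zero (riemannZeta₁_ne_zero_of_riemannHypothesis RH (by linarith))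
      (hadd (by linarith))
  · intro z hz
    have := hball hz
    rw [Real.exp_log h6]
    refine (norm_riemannZeta₁_div_le (by linarith)).trans ?_
    rw [mem_ball_iff_norm] at hz
    have h1 : ‖z - 1‖ ≤ ‖z - c‖ + ‖c - 1‖ := by
      rw [← sub_add_sub_cancel z c 1]
      exact norm_add_le _ _
    have h2 : ‖c - 1‖ ≤ 1 + |s.im| := by
      refine (Complex.norm_le_abs_re_add_abs_im _).trans ?_
      simp [hc]
      norm_num
    have := abs_nonneg s.im
    linarith
  · intro z hz
    have := hball hz
    refine (norm_riemannZeta₁_div_le_tsum (σ := 1 + δ / 2) (by linarith) (by linarith)).trans ?_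
    rw [← Real.log_le_iff_le_exp hpos]
    have := le_abs_self (Real.log K)
    have := abs_nonneg B₀
    linarith
  · refine (hB₀ c rfl).trans ?_
    have := abs_nonneg (Real.log K)
    have := le_abs_self B₀
    linarith
  · have : s - c = ((s.re - 2 : ℝ) : ℂ) := by
      apply Complex.ext <;> simp [hc]
    rw [this, Complex.norm_real, Real.norm_eq_abs, abs_le]
    constructor <;> linarith

end

/-! ### Regularity and growth of `liouvilleSeries`. -/

section

open Filter Asymptotics Topology

lemma one_sub_two_cpow_neg_ne_zero {s : ℂ} (hs : 0 < s.re) : (1 : ℂ) - 2 ^ (-s) ≠ 0 := by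
  intro h
  have hlt := norm_two_cpow_neg_lt_one hs
  rw [sub_eq_zero] at h
  rw [← h] at hlt
  simp at hlt

lemma differentiableAt_liouvilleSeries {s : ℂ} (hs : 1 / 2 < s.re) (h1 : riemannZeta₁ s ≠ 0) :
    DifferentiableAt ℂ liouvilleSeries s := by
  have h2 : 2 * s ≠ 1 := fun h ↦ by
    have := congrArg Complex.re h
    simp at this
    linarith
  have hz : DifferentiableAt ℂ (fun s ↦ riemannZeta (2 * s)) s :=
    (differentiableAt_riemannZeta h2).comp s (differentiableAt_id.const_mul 2)
  have hp : DifferentiableAt ℂ (fun s : ℂ ↦ (2 : ℂ) ^ (-s)) s :=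
    differentiableAt_id.neg.const_cpow (Or.inl two_ne_zero)
  exact ((hz.fun_mul (hp.const_add 1)).fun_div (hp.const_sub 1)
    (one_sub_two_cpow_neg_ne_zero (by linarith))).fun_mul
    ((differentiableAt_id.sub_const 1).fun_div differentiable_riemannZeta₁.differentiableAt h1)

lemma norm_two_cpow_neg_le {σ : ℝ} {s : ℂ} (hs : σ ≤ s.re) : ‖(2 : ℂ) ^ (-s)‖ ≤ 2 ^ (-σ) := by
  have := Complex.norm_natCast_cpow_of_pos (n := 2) two_pos (-s)
  rw [Nat.cast_ofNat] at this
  rw [this, Complex.neg_re, Nat.cast_ofNat]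
  exact Real.rpow_le_rpow_of_exponent_le one_le_two (by linarith)

/-- Here `Re 2s ≥ 1 + 4δ`, so `ζ(2s)` is bounded, as is the factor at 2; only `1/ζ(s)` can grow. -/
lemma exists_norm_liouvilleSeries_le (RH : RiemannHypothesis) {δ η : ℝ} (hδ : 0 < δ)
    (hδ' : δ < 1 / 4) (hη : 0 < η) :
    ∃ C : ℝ, 0 < C ∧ ∀ s : ℂ, 1 / 2 + 2 * δ ≤ s.re → s.re ≤ 2 →
      ‖liouvilleSeries s‖ ≤ C * (1 + |s.im|) ^ η := by
  obtain ⟨C, hC⟩ := exists_norm_add_one_div_riemannZeta₁_le RH hδ hδ' hη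
  set K : ℝ := ∑' n : ℕ, 1 / (n : ℝ) ^ (1 + 4 * δ) with hK
  have hK0 : 0 ≤ K := tsum_nonneg fun n ↦ by positivity
  set D : ℝ := 1 - 2 ^ (-(1 / 2) : ℝ) with hD
  have hD0 : 0 < D := sub_pos.mpr (Real.rpow_lt_one_of_one_lt_of_neg one_lt_two (by norm_num))
  refine ⟨K * 2 / D * |C| + 1, by positivity, fun s hs hs' ↦ ?_⟩
  have h1 : ‖riemannZeta (2 * s)‖ ≤ K := by
    have h2s : 1 + 4 * δ ≤ (2 * s).re := by simp; linarith
    rw [← LSeries_one_eq_riemannZeta (by linarith)]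
    exact norm_LSeries_le_of_norm_le_one (by simp) (by linarith) h2s
  have h2 : ‖(1 : ℂ) + 2 ^ (-s)‖ ≤ 2 := by
    refine (norm_add_le _ _).trans ?_
    have := (norm_two_cpow_neg_lt_one (s := s) (by linarith)).le
    rw [norm_one]
    linarith
  have h3 : D ≤ ‖(1 : ℂ) - 2 ^ (-s)‖ := by
    have h4 := norm_sub_norm_le (1 : ℂ) (2 ^ (-s))
    have h5 := norm_two_cpow_neg_le (σ := 1 / 2) (s := s) (by linarith)
    rw [norm_one] at h4
    linarith
  have h4 : ‖(s - 1) / riemannZeta₁ s‖ ≤ |C| * (1 + |s.im|) ^ η := by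
    have h5 : ‖(s - 1) / riemannZeta₁ s‖ ≤ ‖(s + 1) / riemannZeta₁ s‖ := by
      rw [norm_div, norm_div]
      gcongr
      exact norm_sub_one_le_norm_add_one (by linarith)
    refine h5.trans ((hC s hs hs').trans ?_)
    gcongr
    exact le_abs_self C
  unfold liouvilleSeries
  rw [norm_mul, norm_div, norm_mul]
  have h6 : 0 < (1 + |s.im|) ^ η := by positivity
  calc _ ≤ K * 2 / D * (|C| * (1 + |s.im|) ^ η) := by gcongr
    _ = K * 2 / D * |C| * (1 + |s.im|) ^ η := by ring
    _ ≤ _ := by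
      gcongr
      linarith

end

/-! ### The Tauberian theorem. -/

section

open Filter Asymptotics Topology MeasureTheory FourierTransform

/-- The multiplication formula for the Fourier transform, applied to the modulation of `φ` that
translates `𝓕 φ` by `u`. -/
lemma integral_mul_fourier_comp_sub_eq {f φ : ℝ → ℂ} (hf : Integrable f) (hφ : Integrable φ)
    (u : ℝ) :
    ∫ w, f w * 𝓕 φ (w - u) = ∫ ξ, 𝓕 f ξ * (Real.fourierChar (ξ * u) • φ ξ) := by
  have hg : Integrable (fun ξ ↦ Real.fourierChar (ξ * u) • φ ξ) := by
    have := (Real.fourierIntegral_convergent_iff (μ := volume) (f := φ) (-u)).mpr hφ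
    simpa [mul_comm] using this
  have h := VectorFourier.integral_fourierIntegral_smul_eq_flip (L := innerₗ ℝ)
    Real.continuous_fourierChar continuous_inner hf hg
  rw [flip_innerₗ] at h
  change ∫ ξ, 𝓕 f ξ • _ = ∫ w, f w • 𝓕 (fun ξ ↦ Real.fourierChar (ξ * u) • φ ξ) w at h
  simp only [smul_eq_mul] at h
  rw [h]
  congr 1 with w
  congr 1
  rw [Real.fourier_real_eq, Real.fourier_real_eq]
  congr 1 with v
  rw [smul_smul, ← AddChar.map_add_eq_mul]
  congr 2
  ring

/-- If the Laplace transform of a bounded function `A` extends continuously to the closed half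
plane, then `A` averaged against a band-limited kernel tends to zero. -/
lemma tendsto_integral_mul_fourier_comp_sub {A : ℝ → ℂ} (hA : Measurable A)
    (hA1 : ∀ u, ‖A u‖ ≤ 1) (hA0 : ∀ u < 0, A u = 0) {G : ℂ → ℂ}
    (hG : ContinuousOn G {z | 0 ≤ z.re})
    (hFG : ∀ ρ : ℝ, 0 < ρ → ∀ ξ : ℝ,
      𝓕 (fun w : ℝ ↦ A w * (Real.exp (-ρ * w) : ℂ)) ξ = G (ρ + 2 * Real.pi * ξ * Complex.I))
    {φ : ℝ → ℂ} (hφ : Continuous φ) (hφc : HasCompactSupport φ) (hK : Integrable (𝓕 φ)) :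
    Tendsto (fun u : ℝ ↦ ∫ w, A w * 𝓕 φ (w - u)) atTop (𝓝 0) := by
  have hφi : Integrable φ := hφ.integrable_of_hasCompactSupport hφc
  have hint (ρ : ℝ) (hρ : 0 < ρ) : Integrable (fun w : ℝ ↦ A w * (Real.exp (-ρ * w) : ℂ)) := by
    have h1 : IntegrableOn (fun w : ℝ ↦ A w * (Real.exp (-ρ * w) : ℂ)) (Set.Ici 0) := by
      rw [integrableOn_Ici_iff_integrableOn_Ioi]
      refine Integrable.bdd_mul (c := 1) ?_ hA.aestronglyMeasurable (ae_of_all _ hA1)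
      exact (integrableOn_exp_mul_Ioi (by linarith) 0).ofReal
    rw [← integrableOn_univ]
    refine h1.of_forall_sdiff_eq_zero MeasurableSet.univ fun w hw ↦ ?_
    rw [hA0 w (by simpa using hw.2), zero_mul]
  -- `A` need not be integrable, so it is damped by `exp (-ρ * w)` and `ρ` tends to 0 from the right
  -- on both sides. On the frequency side, domination comes from the boundedness of `G` over the
  -- compact support of `φ`.
  have key (u : ℝ) : ∫ w, A w * 𝓕 φ (w - u) =
      ∫ ξ : ℝ, G (2 * Real.pi * ξ * Complex.I) * (Real.fourierChar (ξ * u) • φ ξ) := by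
    have hK' : Integrable (fun w ↦ 𝓕 φ (w - u)) := hK.comp_sub_right u
    have hlim1 : Tendsto (fun ρ : ℝ ↦ ∫ w : ℝ, A w * (Real.exp (-ρ * w) : ℂ) * 𝓕 φ (w - u))
        (𝓝[>] 0) (𝓝 (∫ w, A w * 𝓕 φ (w - u))) := by
      refine tendsto_integral_filter_of_dominated_convergence (fun w ↦ ‖𝓕 φ (w - u)‖) ?_ ?_
        hK'.norm ?_
      · filter_upwards [self_mem_nhdsWithin] with ρ hρ
        exact (hint ρ hρ).aestronglyMeasurable.mul hK'.aestronglyMeasurable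
      · filter_upwards [self_mem_nhdsWithin] with ρ hρ
        refine ae_of_all _ fun w ↦ ?_
        rw [norm_mul, norm_mul, Complex.norm_real, Real.norm_of_nonneg (Real.exp_pos _).le]
        refine mul_le_of_le_one_left (norm_nonneg _) ?_
        rcases lt_or_ge w 0 with h | h
        · simp [hA0 w h]
        · refine mul_le_one₀ (hA1 w) (Real.exp_pos _).le (Real.exp_le_one_iff.mpr ?_)
          have : 0 < ρ := hρ
          nlinarith
      · refine ae_of_all _ fun w ↦ ?_
        have hc : Continuous fun ρ : ℝ ↦ A w * (Real.exp (-ρ * w) : ℂ) * 𝓕 φ (w - u) := by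
          fun_prop
        have := (hc.tendsto 0).mono_left (nhdsWithin_le_nhds (s := Set.Ioi 0))
        simpa using this
    have hlim2 : Tendsto (fun ρ : ℝ ↦ ∫ ξ : ℝ,
        G (ρ + 2 * Real.pi * ξ * Complex.I) * (Real.fourierChar (ξ * u) • φ ξ)) (𝓝[>] 0)
        (𝓝 (∫ ξ : ℝ, G (2 * Real.pi * ξ * Complex.I) * (Real.fourierChar (ξ * u) • φ ξ))) := by
      have hcomp : IsCompact (Set.Icc (0 : ℝ) 1 ×ˢ tsupport φ) := isCompact_Icc.prod hφc
      have hcont : ContinuousOn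
          (fun p : ℝ × ℝ ↦ G (p.1 + 2 * Real.pi * p.2 * Complex.I)) (Set.Icc (0 : ℝ) 1 ×ˢ tsupport φ) := by
        refine hG.comp (by fun_prop) fun p hp ↦ ?_
        simpa using hp.1.1
      obtain ⟨C, hC⟩ := hcomp.exists_bound_of_continuousOn hcont
      refine tendsto_integral_filter_of_dominated_convergence (fun ξ ↦ C * ‖φ ξ‖) ?_ ?_
        (hφi.norm.const_mul C) ?_
      · filter_upwards [self_mem_nhdsWithin] with ρ hρ
        refine Continuous.aestronglyMeasurable (Continuous.mul ?_ ?_)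
        · refine hG.comp_continuous (by fun_prop) fun ξ ↦ ?_
          simpa using (le_of_lt hρ : (0 : ℝ) ≤ ρ)
        · exact (Real.continuous_fourierChar.comp (by fun_prop)).smul hφ
      · filter_upwards [Ioc_mem_nhdsGT (zero_lt_one (α := ℝ))] with ρ hρ
        refine ae_of_all _ fun ξ ↦ ?_
        rw [norm_mul, Circle.norm_smul]
        by_cases h : ξ ∈ tsupport φ
        · gcongr
          exact hC (ρ, ξ) ⟨⟨hρ.1.le, hρ.2⟩, h⟩
        · simp [image_eq_zero_of_notMem_tsupport h]
      · refine ae_of_all _ fun ξ ↦ Tendsto.mul_const _ ?_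
        have h0 : ContinuousWithinAt G {z | 0 ≤ z.re} (2 * Real.pi * ξ * Complex.I) :=
          hG _ (by simp)
        refine h0.tendsto.comp (tendsto_nhdsWithin_iff.mpr ⟨?_, ?_⟩)
        · have hc : Continuous fun ρ : ℝ ↦ (ρ : ℂ) + 2 * Real.pi * ξ * Complex.I := by fun_prop
          have := (hc.tendsto 0).mono_left (nhdsWithin_le_nhds (s := Set.Ioi 0))
          simpa using this
        · filter_upwards [self_mem_nhdsWithin] with ρ hρ
          simpa using (le_of_lt hρ : (0 : ℝ) ≤ ρ)
    refine tendsto_nhds_unique hlim1 (hlim2.congr' ?_)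
    filter_upwards [self_mem_nhdsWithin] with ρ hρ
    rw [integral_mul_fourier_comp_sub_eq (hint ρ hρ) hφi]
    simp_rw [hFG ρ hρ]
  simp_rw [key]
  -- Only an oscillating integral over boundary values of `G` remains, and the Riemann–Lebesgue
  -- lemma applies.
  have hRL := Real.tendsto_integral_exp_smul_cocompact
    (fun ξ : ℝ ↦ G (2 * Real.pi * ξ * Complex.I) * φ ξ)
  have hneg : Tendsto (fun u : ℝ ↦ -u) atTop (cocompact ℝ) :=
    tendsto_neg_atTop_atBot.mono_right atBot_le_cocompact
  refine (hRL.comp hneg).congr fun u ↦ ?_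
  simp only [Function.comp_apply]
  congr 1 with ξ
  rw [mul_smul_comm]
  congr 2
  ring_nf

lemma fourier_comp_div (φ : ℝ → ℂ) {l : ℝ} (hl : 0 < l) (w : ℝ) :
    𝓕 (fun ξ ↦ φ (ξ / l)) w = l * 𝓕 φ (l * w) := by
  rw [Real.fourier_real_eq, Real.fourier_real_eq]
  have h := Measure.integral_comp_div (fun v : ℝ ↦ Real.fourierChar (-(v * (l * w))) • φ v) l
  rw [abs_of_pos hl, Complex.real_smul] at h
  rw [← h]
  congr 1 with v
  congr 3
  field_simp

lemma integral_mul_fourier_comp_div_comp_sub (A φ : ℝ → ℂ) {l : ℝ} (hl : 0 < l) (u : ℝ) :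
    ∫ w, A w * 𝓕 (fun ξ ↦ φ (ξ / l)) (w - u) = ∫ v, A (u + v / l) * 𝓕 φ v := by
  rw [← integral_add_right_eq_self _ u]
  have h := Measure.integral_comp_mul_left (fun v : ℝ ↦ A (u + v / l) * 𝓕 φ v) l
  rw [abs_of_pos (inv_pos.mpr hl), Complex.real_smul] at h
  have hl' : (l : ℂ) ≠ 0 := by exact_mod_cast hl.ne'
  rw [Complex.ofReal_inv, eq_inv_mul_iff_mul_eq₀ hl'] at h
  rw [← h, ← integral_const_mul]
  congr 1 with v
  rw [add_sub_cancel_right, fourier_comp_div φ hl, mul_div_cancel_left₀ _ hl.ne', add_comm u]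
  ring

/-- A band-limited integrable kernel of total mass one. -/
lemma exists_fourier_kernel : ∃ φ : ℝ → ℂ, Continuous φ ∧ HasCompactSupport φ ∧
    Integrable (𝓕 φ) ∧ ∫ v, 𝓕 φ v = 1 := by
  let b : ContDiffBump (0 : ℝ) := ⟨1, 2, one_pos, one_lt_two⟩
  have hs : HasCompactSupport (fun x ↦ (b x : ℂ)) :=
    b.hasCompactSupport.comp_left (g := ((↑) : ℝ → ℂ)) Complex.ofReal_zero
  have hd : ContDiff ℝ (⊤ : ℕ∞) (fun x ↦ (b x : ℂ)) := Complex.ofRealCLM.contDiff.comp b.contDiff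
  let ψ : SchwartzMap ℝ ℂ := hs.toSchwartzMap hd
  have hi : Integrable (𝓕 (ψ : ℝ → ℂ)) := (𝓕 ψ).integrable
  refine ⟨ψ, ψ.continuous, hs, hi, ?_⟩
  have h := congrFun (ψ.continuous.fourierInv_fourier_eq ψ.integrable hi) 0
  rw [Real.fourierInv_eq] at h
  simp only [inner_zero_right, AddChar.map_zero_eq_one, one_smul] at h
  rw [h]
  change ((b 0 : ℝ) : ℂ) = 1
  rw [b.one_of_mem_closedBall (by simp [b])]
  simp

/-- A Tauberian theorem for slowly oscillating functions whose Laplace transform extends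
continuously to the closed half plane. -/
theorem tendsto_zero_of_laplace_continuousOn {A : ℝ → ℂ} (hA : Measurable A)
    (hA1 : ∀ u, ‖A u‖ ≤ 1) (hA0 : ∀ u < 0, A u = 0)
    (hosc : ∀ u v, ‖A u - A (u + v)‖ ≤ min 2 (2 * |Real.exp v - 1|) + Real.exp (-u)) {G : ℂ → ℂ}
    (hG : ContinuousOn G {z | 0 ≤ z.re})
    (hFG : ∀ ρ : ℝ, 0 < ρ → ∀ ξ : ℝ,
      𝓕 (fun w : ℝ ↦ A w * (Real.exp (-ρ * w) : ℂ)) ξ = G (ρ + 2 * Real.pi * ξ * Complex.I)) :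
    Tendsto A atTop (𝓝 0) := by
  obtain ⟨φ, hφ, hφc, hK, hK1⟩ := exists_fourier_kernel
  -- Narrowing the kernel by the factor `n + 1` makes the oscillation error small. The cap 2 in the
  -- modulus supplies the dominating function, since `exp v` need not be integrable against the
  -- kernel.
  have hωlim : Tendsto (fun n : ℕ ↦
      ∫ v, min 2 (2 * |Real.exp (v / (n + 1 : ℝ)) - 1|) * ‖𝓕 φ v‖) atTop (𝓝 0) := by
    have h0 : (0 : ℝ) = ∫ v : ℝ, (0 : ℝ) := by simp
    rw [h0]
    refine tendsto_integral_of_dominated_convergence (fun v ↦ 2 * ‖𝓕 φ v‖) (fun n ↦ ?_)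
      (hK.norm.const_mul 2) (fun n ↦ ae_of_all _ fun v ↦ ?_) (ae_of_all _ fun v ↦ ?_)
    · exact (Continuous.aestronglyMeasurable (by fun_prop)).mul hK.norm.aestronglyMeasurable
    · rw [Real.norm_of_nonneg (by positivity)]
      gcongr
      exact min_le_left _ _
    · have h1 : Tendsto (fun n : ℕ ↦ v / (n + 1 : ℝ)) atTop (𝓝 0) := by
        have := (tendsto_one_div_add_atTop_nhds_zero_nat (𝕜 := ℝ)).const_mul v
        rw [mul_zero] at this
        refine this.congr fun n ↦ ?_
        rw [mul_one_div]
      have hc : Continuous fun x : ℝ ↦ min 2 (2 * |Real.exp x - 1|) * ‖𝓕 φ v‖ := by fun_prop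
      have := (hc.tendsto 0).comp h1
      simp only [Real.exp_zero, sub_self, abs_zero, mul_zero, zero_mul,
        min_eq_right (zero_le_two (α := ℝ))] at this
      exact this
  set I : ℝ := ∫ v, ‖𝓕 φ v‖ with hI
  rw [Metric.tendsto_nhds]
  intro ε hε
  obtain ⟨n, hn⟩ := (hωlim.eventually_lt_const (half_pos hε)).exists
  have hl : (0 : ℝ) < n + 1 := by positivity
  have hlim : Tendsto (fun u : ℝ ↦ ‖∫ v, A (u + v / (n + 1)) * 𝓕 φ v‖ + Real.exp (-u) * I)
      atTop (𝓝 0) := by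
    have hKl : Integrable (𝓕 (fun ξ ↦ φ (ξ / (n + 1 : ℝ)))) := by
      have : 𝓕 (fun ξ ↦ φ (ξ / (n + 1 : ℝ))) =
          fun w ↦ ((n + 1 : ℝ) : ℂ) * 𝓕 φ ((n + 1 : ℝ) * w) :=
        funext fun w ↦ fourier_comp_div φ hl w
      rw [this]
      exact (hK.comp_mul_left' hl.ne').const_mul _
    have h1 := tendsto_integral_mul_fourier_comp_sub hA hA1 hA0 hG hFG
      (φ := fun ξ ↦ φ (ξ / (n + 1 : ℝ))) (by fun_prop)
      (by
        simpa only [div_eq_mul_inv] using!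
          hφc.comp_homeomorph (Homeomorph.mulRight₀ (n + 1 : ℝ)⁻¹ (inv_ne_zero hl.ne'))) hKl
    simp_rw [integral_mul_fourier_comp_div_comp_sub A φ hl] at h1
    have h2 := (Real.tendsto_exp_neg_atTop_nhds_zero).mul_const I
    simpa using h1.norm.add h2
  filter_upwards [hlim.eventually_lt_const (half_pos hε)] with u hu
  rw [dist_zero_right]
  have hAint : Integrable fun v ↦ A (u + v / (n + 1)) * 𝓕 φ v :=
    hK.bdd_mul (c := 1) (Measurable.aestronglyMeasurable (by fun_prop))
      (ae_of_all _ fun v ↦ hA1 _)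
  have hωint : Integrable fun v ↦ min 2 (2 * |Real.exp (v / (n + 1 : ℝ)) - 1|) * ‖𝓕 φ v‖ := by
    refine hK.norm.bdd_mul (c := 2) (Continuous.aestronglyMeasurable (by fun_prop))
      (ae_of_all _ fun v ↦ ?_)
    rw [Real.norm_of_nonneg (by positivity)]
    exact min_le_left _ _
  -- The kernel has mass one, so `A u` is its local average plus an average of differences;
  -- positivity of the kernel is not needed.
  have h1 : A u = (∫ v, A (u + v / (n + 1)) * 𝓕 φ v) +
      ∫ v, (A u - A (u + v / (n + 1))) * 𝓕 φ v := by
    simp_rw [sub_mul]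
    rw [integral_sub (hK.const_mul _) hAint, integral_const_mul, hK1]
    ring
  have h2 : ‖∫ v, (A u - A (u + v / (n + 1))) * 𝓕 φ v‖ ≤
      (∫ v, min 2 (2 * |Real.exp (v / (n + 1 : ℝ)) - 1|) * ‖𝓕 φ v‖) + Real.exp (-u) * I := by
    rw [hI, ← integral_const_mul, ← integral_add hωint (hK.norm.const_mul _)]
    refine norm_integral_le_of_norm_le (hωint.add (hK.norm.const_mul _))
      (ae_of_all _ fun v ↦ ?_)
    rw [norm_mul, ← add_mul]
    gcongr
    exact hosc u _
  have h3 := norm_add_le (∫ v, A (u + v / (n + 1)) * 𝓕 φ v)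
    (∫ v, (A u - A (u + v / (n + 1))) * 𝓕 φ v)
  rw [← h1] at h3
  linarith

end

/-! ### From Dirichlet series to the unconditional `o(x)`. -/

section

open Filter Asymptotics Topology MeasureTheory FourierTransform

lemma norm_sum_Icc_floor_le {a : ℕ → ℂ} (ha : ∀ n, ‖a n‖ ≤ 1) {x : ℝ} (hx : 0 ≤ x) :
    ‖∑ k ∈ Finset.Icc 1 ⌊x⌋₊, a k‖ ≤ x := by
  refine (norm_sum_le_of_le _ fun k _ ↦ ha k).trans ?_
  simpa using Nat.floor_le hx

lemma norm_sum_Icc_floor_sub_le {a : ℕ → ℂ} (ha : ∀ n, ‖a n‖ ≤ 1) {x y : ℝ} (hx : 0 ≤ x)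
    (hxy : x ≤ y) :
    ‖∑ k ∈ Finset.Icc 1 ⌊y⌋₊, a k - ∑ k ∈ Finset.Icc 1 ⌊x⌋₊, a k‖ ≤ y - x + 1 := by
  have hfl : ⌊x⌋₊ ≤ ⌊y⌋₊ := Nat.floor_mono hxy
  have h : ∑ k ∈ Finset.Icc 1 ⌊y⌋₊, a k - ∑ k ∈ Finset.Icc 1 ⌊x⌋₊, a k =
      ∑ k ∈ Finset.Ioc ⌊x⌋₊ ⌊y⌋₊, a k := by
    have hIcc (n : ℕ) : Finset.Icc 1 n = Finset.Ioc 0 n := rfl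
    rw [sub_eq_iff_eq_add', hIcc, hIcc, Finset.sum_Ioc_consecutive _ (Nat.zero_le _) hfl]
  rw [h]
  refine (norm_sum_le_of_le _ fun k _ ↦ ha k).trans ?_
  simp only [Finset.sum_const, Nat.card_Ioc, nsmul_eq_mul, mul_one]
  rw [Nat.cast_sub hfl]
  have h1 := Nat.floor_le (hx.trans hxy)
  have h2 := Nat.lt_floor_add_one x
  linarith

lemma measurable_sum_Icc_floor (a : ℕ → ℂ) :
    Measurable fun x : ℝ ↦ ∑ k ∈ Finset.Icc 1 ⌊x⌋₊, a k :=
  (measurable_from_nat (f := fun n ↦ ∑ k ∈ Finset.Icc 1 n, a k)).comp Nat.measurable_floor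

/-- This is `L(s)/s = ∫ S(t) t^(-s-1) dt` by partial summation. The argument is inverted because
`mellin_eq_fourier` substitutes `exp (-u)`, and `S (exp u)` is wanted. -/
lemma mellin_sum_Icc_floor_inv {a : ℕ → ℂ} (ha : ∀ n, ‖a n‖ ≤ 1) {s : ℂ} (hs : 1 < s.re) :
    mellin (fun x : ℝ ↦ ∑ k ∈ Finset.Icc 1 ⌊x⁻¹⌋₊, a k) s = LSeries a s / s := by
  have hs0 : s ≠ 0 := Complex.ne_zero_of_one_lt_re hs
  have h := LSeries_eq_mul_integral' a (r := 1) zero_le_one hs (by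
    refine IsBigO.of_bound 1 (Eventually.of_forall fun n ↦ ?_)
    rw [Real.norm_of_nonneg (by positivity), Real.rpow_one, one_mul, Real.norm_natCast]
    refine (Finset.sum_le_sum fun k _ ↦ ha k).trans ?_
    simp)
  rw [h, mul_div_cancel_left₀ _ hs0,
    mellin_comp_inv (fun x : ℝ ↦ ∑ k ∈ Finset.Icc 1 ⌊x⌋₊, a k) s, mellin]
  rw [← integral_indicator measurableSet_Ioi, ← integral_indicator measurableSet_Ioi]
  refine integral_congr_ae ?_
  filter_upwards [compl_mem_ae_iff.mpr (measure_singleton (1 : ℝ))] with t ht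
  have ht1 : t ≠ 1 := ht
  rcases lt_or_gt_of_ne ht1 with h | h
  · have h1 : ⌊t⌋₊ = 0 := Nat.floor_eq_zero.mpr h
    simp [Set.indicator, h1]
  · have h0 : 0 < t := by linarith
    simp only [Set.indicator, Set.mem_Ioi, h, h0, if_true, smul_eq_mul]
    rw [mul_comm, neg_add']

/-- If `∑ a n / n ^ s` with `|a n| ≤ 1` extends continuously to `1 ≤ Re s`, then
`∑_{n ≤ x} a n = o(x)`. -/
theorem isLittleO_sum_of_LSeries_continuousOn {a : ℕ → ℂ} (ha : ∀ n, ‖a n‖ ≤ 1) {H : ℂ → ℂ}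
    (hH : ContinuousOn H {s | 1 ≤ s.re}) (hL : ∀ s : ℂ, 1 < s.re → LSeries a s = H s) :
    (fun x : ℝ ↦ ∑ k ∈ Finset.Icc 1 ⌊x⌋₊, a k) =o[atTop] (fun x : ℝ ↦ x) := by
  set S : ℝ → ℂ := fun x ↦ ∑ k ∈ Finset.Icc 1 ⌊x⌋₊, a k with hS
  set A : ℝ → ℂ := fun u ↦ S (Real.exp u) * (Real.exp (-u) : ℂ) with hA
  have hnormA (u : ℝ) : ‖A u‖ = ‖S (Real.exp u)‖ * Real.exp (-u) := by
    rw [hA, norm_mul, Complex.norm_real, Real.norm_of_nonneg (Real.exp_pos _).le]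
  have hexp (u : ℝ) : Real.exp u * Real.exp (-u) = 1 := by
    rw [← Real.exp_add, add_neg_cancel, Real.exp_zero]
  have hA1 (u : ℝ) : ‖A u‖ ≤ 1 := by
    rw [hnormA, ← hexp u]
    gcongr
    exact norm_sum_Icc_floor_le ha (Real.exp_pos u).le
  have hSmeas : Measurable S := measurable_sum_Icc_floor a
  -- One `|exp v - 1|` comes from the change of `S`, the other from the change of the normalising
  -- factor; `exp (-u)` is the rounding error of the floors.
  have hosc (u v : ℝ) : ‖A u - A (u + v)‖ ≤ min 2 (2 * |Real.exp v - 1|) + Real.exp (-u) := by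
    rw [← min_add_add_right]
    refine le_min ?_ ?_
    · have h1 := norm_sub_le (A u) (A (u + v))
      have h2 := Real.exp_pos (-u)
      linarith [hA1 u, hA1 (u + v)]
    · have hdiff : ‖S (Real.exp u) - S (Real.exp (u + v))‖ ≤
          Real.exp u * |Real.exp v - 1| + 1 := by
        have h1 : |Real.exp (u + v) - Real.exp u| = Real.exp u * |Real.exp v - 1| := by
          rw [Real.exp_add, ← abs_of_pos (Real.exp_pos u), ← abs_mul, abs_of_pos (Real.exp_pos u)]
          congr 1
          ring
        rw [← h1]
        rcases le_total (Real.exp u) (Real.exp (u + v)) with h | h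
        · rw [norm_sub_rev, abs_of_nonneg (sub_nonneg.mpr h)]
          exact norm_sum_Icc_floor_sub_le ha (Real.exp_pos _).le h
        · rw [abs_sub_comm, abs_of_nonneg (sub_nonneg.mpr h)]
          exact norm_sum_Icc_floor_sub_le ha (Real.exp_pos _).le h
      have hS2 : ‖S (Real.exp (u + v))‖ ≤ Real.exp (u + v) :=
        norm_sum_Icc_floor_le ha (Real.exp_pos _).le
      have heq : A u - A (u + v) = (S (Real.exp u) - S (Real.exp (u + v))) * (Real.exp (-u) : ℂ) +
          S (Real.exp (u + v)) * ((Real.exp (-u) - Real.exp (-(u + v)) : ℝ) : ℂ) := by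
        simp only [hA]
        push_cast
        ring
      have h3 : |Real.exp (-u) - Real.exp (-(u + v))| =
          Real.exp (-(u + v)) * |Real.exp v - 1| := by
        rw [← abs_of_pos (Real.exp_pos (-(u + v))), ← abs_mul, abs_of_pos (Real.exp_pos _),
          mul_sub, ← Real.exp_add]
        congr 2 <;> ring_nf
      rw [heq]
      refine (norm_add_le _ _).trans ?_
      rw [norm_mul, norm_mul, Complex.norm_real, Complex.norm_real, Real.norm_eq_abs,
        Real.norm_eq_abs, h3, abs_of_pos (Real.exp_pos _)]
      calc _ ≤ (Real.exp u * |Real.exp v - 1| + 1) * Real.exp (-u) +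
            Real.exp (u + v) * (Real.exp (-(u + v)) * |Real.exp v - 1|) := by gcongr
        _ = (Real.exp u * Real.exp (-u)) * |Real.exp v - 1| + Real.exp (-u) +
            (Real.exp (u + v) * Real.exp (-(u + v))) * |Real.exp v - 1| := by ring
        _ = _ := by
          rw [hexp, hexp]
          ring
  have hlim : Tendsto A atTop (𝓝 0) := by
    refine tendsto_zero_of_laplace_continuousOn (G := fun z ↦ H (1 + z) / (1 + z))
      (by fun_prop) hA1 ?_ hosc ?_ ?_
    · intro u hu
      have : ⌊Real.exp u⌋₊ = 0 := Nat.floor_eq_zero.mpr (Real.exp_lt_one_iff.mpr hu)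
      simp [hA, hS, this]
    · refine ContinuousOn.div (hH.comp (by fun_prop) fun z hz ↦ ?_) (by fun_prop) fun z hz h ↦ ?_
      · simpa using hz
      · have := congrArg Complex.re h
        have hz' : 0 ≤ z.re := hz
        simp at this
        linarith
    · intro ρ hρ ξ
      have hre : (1 + (ρ + 2 * Real.pi * ξ * Complex.I) : ℂ).re = 1 + ρ := by simp
      have him : (1 + (ρ + 2 * Real.pi * ξ * Complex.I) : ℂ).im = 2 * Real.pi * ξ := by simp
      have h1 : 1 < (1 + (ρ + 2 * Real.pi * ξ * Complex.I) : ℂ).re := by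
        rw [hre]
        linarith
      rw [← hL _ h1, ← mellin_sum_Icc_floor_inv ha h1, mellin_eq_fourier, hre, him,
        mul_div_cancel_left₀ _ (by positivity)]
      refine congrArg (fun f : ℝ → ℂ ↦ 𝓕 f ξ) (funext fun w ↦ ?_)
      rw [← Real.exp_neg, neg_neg, Complex.real_smul, hA, mul_assoc, ← Complex.ofReal_mul,
        ← Real.exp_add, mul_comm]
      congr 3
      ring
  refine isLittleO_iff.mpr fun c hc ↦ ?_
  have h1 := (hlim.comp Real.tendsto_log_atTop).norm.eventually_lt_const (by simpa using hc)
  filter_upwards [h1, eventually_gt_atTop 0] with x hx hx0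
  rw [Function.comp_apply, hnormA, Real.exp_neg, Real.exp_log hx0, ← div_eq_mul_inv,
    div_lt_iff₀ hx0] at hx
  rw [Real.norm_of_nonneg hx0.le]
  exact hx.le

lemma norm_sum_liouvilleAP (x : ℝ) :
    ‖∑ k ∈ Finset.Icc 1 ⌊x⌋₊, (liouvilleAP k 2 1 : ℂ)‖ = |(sumLiouvilleAP x 2 1 : ℝ)| := by
  rw [← Int.cast_sum, Complex.norm_intCast]
  rfl

theorem sumLiouvilleAP_two_one_isLittleO :
    (fun x : ℝ ↦ (sumLiouvilleAP x 2 1 : ℝ)) =o[atTop] (fun x : ℝ ↦ x) := by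
  have h := isLittleO_sum_of_LSeries_continuousOn (a := fun n ↦ (liouvilleAP n 2 1 : ℂ))
    (fun n ↦ (norm_liouvilleAP n 2 1).le) (H := liouvilleSeries)
    (fun s hs ↦ (differentiableAt_liouvilleSeries (lt_of_lt_of_le (by norm_num) hs)
      (riemannZeta₁_ne_zero_of_one_le_re hs)).continuousAt.continuousWithinAt)
    (fun s hs ↦ LSeries_liouvilleAP_eq hs)
  refine IsBigO.trans_isLittleO (IsBigO.of_bound 1 (Eventually.of_forall fun x ↦ ?_)) h
  rw [norm_sum_liouvilleAP, one_mul, Real.norm_eq_abs]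

end

/-! ### Smoothed Perron formula and contour shift. -/

section

open Filter Asymptotics Topology MeasureTheory

lemma one_add_abs_im_div_three_le_norm {s : ℂ} (hs : 1 / 2 ≤ s.re) :
    (1 + |s.im|) / 3 ≤ ‖s‖ := by
  have h1 := (le_abs_self _).trans (Complex.abs_re_le_norm s)
  have h2 := Complex.abs_im_le_norm s
  linarith

lemma integrable_one_add_abs_rpow {r : ℝ} (hr : 1 < r) :
    Integrable fun t : ℝ ↦ (1 + |t|) ^ (-r) := by
  have := integrable_one_add_norm (E := ℝ) (μ := volume) (r := r) (by simpa using hr)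
  simpa using this

lemma inv_norm_mul_norm_add_one_le {s : ℂ} (hs : 1 / 2 ≤ s.re) :
    ‖(s * (s + 1))⁻¹‖ ≤ 9 * (1 + |s.im|) ^ (-2 : ℝ) := by
  have h0 : 0 < 1 + |s.im| := by positivity
  have h1 := one_add_abs_im_div_three_le_norm hs
  have h2 := one_add_abs_im_div_three_le_norm (s := s + 1) (by simp; linarith)
  rw [Complex.add_im, Complex.one_im, add_zero] at h2
  rw [norm_inv, norm_mul, Real.rpow_neg h0.le, ← div_eq_mul_inv, ← inv_div, Real.rpow_two]
  refine inv_anti₀ (by positivity) ?_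
  calc (1 + |s.im|) ^ 2 / 9 = (1 + |s.im|) / 3 * ((1 + |s.im|) / 3) := by ring
    _ ≤ _ := by gcongr

lemma integrable_inv_mul_add_one {σ : ℝ} (hσ : 1 / 2 ≤ σ) :
    Integrable fun y : ℝ ↦ (((σ : ℂ) + y * Complex.I) * ((σ : ℂ) + y * Complex.I + 1))⁻¹ := by
  refine Integrable.mono' ((integrable_one_add_abs_rpow one_lt_two).const_mul 9)
    (Measurable.aestronglyMeasurable (by fun_prop)) (ae_of_all _ fun y ↦ ?_)
  have := inv_norm_mul_norm_add_one_le (s := (σ : ℂ) + y * Complex.I) (by simpa using hσ)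
  simpa using this

/-- The Mellin transform of `max (1 - x) 0`. -/
lemma hasMellin_max_one_sub {s : ℂ} (hs : 0 < s.re) :
    HasMellin (fun x : ℝ ↦ ((max (1 - x) 0 : ℝ) : ℂ)) s (s * (s + 1))⁻¹ := by
  have h1 := hasMellin_one_Ioc hs
  have h2 := hasMellin_cpow_Ioc 1 (s := s) (by simp; linarith)
  have h3 := hasMellin_sub h1.1 h2.1
  have hs0 : s ≠ 0 := by rintro rfl; simp at hs
  have hs1 : s + 1 ≠ 0 := fun h ↦ by
    have := congrArg Complex.re h
    simp at this
    linarith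
  have heq : Set.EqOn (fun t : ℝ ↦ (t : ℂ) ^ (s - 1) • (Set.indicator (Set.Ioc 0 1) (fun _ ↦ 1 : ℝ → ℂ) t -
      Set.indicator (Set.Ioc 0 1) (fun t ↦ (t : ℂ) ^ (1 : ℂ) : ℝ → ℂ) t))
      (fun t ↦ (t : ℂ) ^ (s - 1) • ((max (1 - t) 0 : ℝ) : ℂ)) (Set.Ioi 0) := by
    intro t ht
    have ht0 : 0 < t := ht
    simp only
    congr 1
    by_cases h : t ≤ 1
    · simp [Set.indicator, ht0, h]
    · simp [Set.indicator, h, max_eq_right (by linarith : 1 - t ≤ 0)]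
  refine ⟨(integrableOn_congr_fun heq measurableSet_Ioi).mp h3.1, ?_⟩
  rw [mellin, ← setIntegral_congr_fun measurableSet_Ioi heq]
  refine h3.2.trans ?_
  rw [h1.2, h2.2]
  field_simp
  ring

lemma max_one_sub_eq_integral {σ x : ℝ} (hσ : 1 / 2 ≤ σ) (hx : 0 < x) :
    ((max (1 - x) 0 : ℝ) : ℂ) = (2 * Real.pi : ℂ)⁻¹ * ∫ y : ℝ,
      (x : ℂ) ^ (-((σ : ℂ) + y * Complex.I)) *
        (((σ : ℂ) + y * Complex.I) * ((σ : ℂ) + y * Complex.I + 1))⁻¹ := by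
  have hM (y : ℝ) := hasMellin_max_one_sub (s := (σ : ℂ) + y * Complex.I) (by simp; linarith)
  have h := mellinInv_mellin_eq σ (fun x : ℝ ↦ ((max (1 - x) 0 : ℝ) : ℂ)) hx
    (by simpa using (hM 0).1) (by
      simp_rw [Complex.VerticalIntegrable, (hM _).2]
      exact integrable_inv_mul_add_one hσ) (by fun_prop)
  rw [← h, mellinInv, Complex.real_smul]
  simp_rw [(hM _).2, smul_eq_mul]
  simp

/-- The absolutely convergent form of Perron's formula. -/
lemma sum_mul_sub_eq_integral {a : ℕ → ℂ} (ha : ∀ n, ‖a n‖ ≤ 1) {X : ℝ} (hX : 0 < X) :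
    ∑ n ∈ Finset.Icc 1 ⌊X⌋₊, a n * ((X - n : ℝ) : ℂ) = (2 * Real.pi : ℂ)⁻¹ * ∫ y : ℝ,
      (X : ℂ) ^ (((2 : ℝ) : ℂ) + y * Complex.I + 1) * LSeries a (((2 : ℝ) : ℂ) + y * Complex.I) *
        ((((2 : ℝ) : ℂ) + y * Complex.I) * (((2 : ℝ) : ℂ) + y * Complex.I + 1))⁻¹ := by
  set s : ℝ → ℂ := fun y ↦ ((2 : ℝ) : ℂ) + y * Complex.I with hs
  have hre (y : ℝ) : (s y).re = 2 := by simp [hs]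
  have hs0 (y : ℝ) : s y ≠ 0 := fun h ↦ by simpa [h] using hre y
  have hX' : (X : ℂ) ≠ 0 := by exact_mod_cast hX.ne'
  -- Mellin inversion of `max (1 - x) 0` at `x = n / X` produces each weight `X - n`, and 0 for `n >
  -- X`. The decay of `1/(s(s+1))` allows sum and integral to be exchanged.
  set F : ℕ → ℝ → ℂ := fun n y ↦
    X * (a n * (((n / X : ℝ) : ℂ) ^ (-s y) * (s y * (s y + 1))⁻¹)) with hF
  have hk : Integrable fun y ↦ (s y * (s y + 1))⁻¹ := integrable_inv_mul_add_one (by norm_num)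
  have hnorm (n : ℕ) (y : ℝ) :
      ‖((n / X : ℝ) : ℂ) ^ (-s y)‖ = (n / X : ℝ) ^ (-2 : ℝ) := by
    rw [Complex.norm_cpow_eq_rpow_re_of_nonneg (by positivity) (by simp [hre]), Complex.neg_re, hre]
  have hFint (n : ℕ) : Integrable (F n) := by
    refine Integrable.const_mul (Integrable.const_mul ?_ _) _
    rcases eq_or_ne n 0 with rfl | hn
    · have (y : ℝ) : ((0 : ℂ)) ^ (-s y) = 0 := Complex.zero_cpow (neg_ne_zero.mpr (hs0 y))
      simp [this]
    · refine hk.bdd_mul (c := (n / X : ℝ) ^ (-2 : ℝ)) (Continuous.aestronglyMeasurable ?_)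
        (ae_of_all _ fun y ↦ (hnorm n y).le)
      have hne : ((n / X : ℝ) : ℂ) ≠ 0 := by
        exact_mod_cast (div_pos (by positivity) hX).ne'
      exact Continuous.const_cpow (by fun_prop) (Or.inl hne)
  have hFsum : Summable fun n ↦ ∫ y, ‖F n y‖ := by
    have h1 : Summable fun n : ℕ ↦ (n : ℝ) ^ (-2 : ℝ) :=
      Real.summable_nat_rpow.mpr (by norm_num)
    refine Summable.of_nonneg_of_le (fun n ↦ by positivity) (fun n ↦ ?_)
      (h1.mul_left (X * (X⁻¹ ^ (-2 : ℝ)) * ∫ y, ‖(s y * (s y + 1))⁻¹‖))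
    have h2 : (fun y ↦ ‖F n y‖) =
        fun y ↦ X * ‖a n‖ * (n / X : ℝ) ^ (-2 : ℝ) * ‖(s y * (s y + 1))⁻¹‖ := by
      ext y
      simp only [hF, norm_mul, hnorm, Complex.norm_real, Real.norm_of_nonneg hX.le]
      ring
    rw [h2, integral_const_mul, div_eq_mul_inv, Real.mul_rpow (by positivity) (by positivity)]
    calc X * ‖a n‖ * ((n : ℝ) ^ (-2 : ℝ) * X⁻¹ ^ (-2 : ℝ)) * ∫ y, ‖(s y * (s y + 1))⁻¹‖
        ≤ X * 1 * ((n : ℝ) ^ (-2 : ℝ) * X⁻¹ ^ (-2 : ℝ)) * ∫ y, ‖(s y * (s y + 1))⁻¹‖ := by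
          gcongr
          exact ha n
      _ = _ := by ring
  have key := hasSum_integral_of_summable_integral_norm hFint hFsum
  have htsum (y : ℝ) : ∑' n, F n y =
      (X : ℂ) ^ (s y + 1) * LSeries a (s y) * (s y * (s y + 1))⁻¹ := by
    rw [LSeries, ← tsum_mul_left, ← tsum_mul_right]
    refine tsum_congr fun n ↦ ?_
    rw [LSeries.term_of_ne_zero' (hs0 y), Complex.cpow_add _ _ hX', Complex.cpow_one]
    simp only [hF]
    rw [Complex.ofReal_div, Complex.div_cpow_ofReal_nonneg (by positivity) hX.le,
      Complex.cpow_neg, Complex.cpow_neg, Complex.ofReal_natCast, div_inv_eq_mul]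
    ring
  simp_rw [htsum] at key
  rw [← key.tsum_eq]
  have hterm (n : ℕ) (hn : n ≠ 0) : (2 * Real.pi : ℂ)⁻¹ * ∫ y, F n y =
      X * (a n * ((max (1 - n / X) 0 : ℝ) : ℂ)) := by
    simp only [hF, integral_const_mul]
    rw [max_one_sub_eq_integral (σ := 2) (by norm_num) (div_pos (by positivity) hX)]
    ring
  have hzero : ∫ y, F 0 y = 0 := by
    have (y : ℝ) : F 0 y = 0 := by
      have : ((0 : ℂ)) ^ (-s y) = 0 := Complex.zero_cpow (neg_ne_zero.mpr (hs0 y))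
      simp [hF, this]
    simp [this]
  rw [← tsum_mul_left, tsum_eq_sum (s := Finset.Icc 1 ⌊X⌋₊)]
  · refine Finset.sum_congr rfl fun n hn ↦ ?_
    rw [Finset.mem_Icc] at hn
    have hnX : (n : ℝ) ≤ X := (Nat.le_floor_iff hX.le).mp hn.2
    rw [hterm n (by omega), max_eq_left (sub_nonneg.mpr ((div_le_one hX).mpr hnX))]
    push_cast
    field_simp
  · intro n hn
    rcases eq_or_ne n 0 with rfl | hn0
    · rw [hzero, mul_zero]
    · have hnX : X < n := by
        rw [Finset.mem_Icc, not_and, not_le] at hn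
        exact Nat.lt_of_floor_lt (hn (by omega))
      rw [hterm n hn0, max_eq_right (by linarith [(one_lt_div hX).mpr hnX])]
      simp

/-- Shifting a vertical line of integration. -/
lemma integral_vertical_line_eq {f : ℂ → ℂ} {a b : ℝ} (hab : a ≤ b)
    (hf : ∀ s : ℂ, a ≤ s.re → s.re ≤ b → DifferentiableAt ℂ f s) {g : ℝ → ℝ}
    (hg : Integrable g) (hg0 : Tendsto g (cocompact ℝ) (𝓝 0))
    (hfg : ∀ s : ℂ, a ≤ s.re → s.re ≤ b → ‖f s‖ ≤ g s.im) :
    ∫ y : ℝ, f (a + y * Complex.I) = ∫ y : ℝ, f (b + y * Complex.I) := by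
  have hint (c : ℝ) (hac : a ≤ c) (hcb : c ≤ b) : Integrable fun y : ℝ ↦ f (c + y * Complex.I) := by
    refine hg.mono' (Continuous.aestronglyMeasurable ?_) (ae_of_all _ fun y ↦ ?_)
    · rw [continuous_iff_continuousAt]
      intro y
      exact ContinuousAt.comp (f := fun y : ℝ ↦ (c : ℂ) + y * Complex.I)
        (hf _ (by simpa using hac) (by simpa using hcb)).continuousAt (by fun_prop)
    · simpa using hfg (c + y * Complex.I) (by simpa using hac) (by simpa using hcb)
  have hvert (c : ℝ) (hac : a ≤ c) (hcb : c ≤ b) :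
      Tendsto (fun T : ℝ ↦ ∫ y in (-T)..T, f (c + y * Complex.I)) atTop
        (𝓝 (∫ y : ℝ, f (c + y * Complex.I))) :=
    intervalIntegral_tendsto_integral (hint c hac hcb) tendsto_neg_atTop_atBot tendsto_id
  have hhor {u : ℝ → ℝ} (hu : Tendsto u atTop (cocompact ℝ)) :
      Tendsto (fun T : ℝ ↦ ∫ x in a..b, f (x + u T * Complex.I)) atTop (𝓝 0) := by
    have h1 : Tendsto (fun T ↦ g (u T) * |b - a|) atTop (𝓝 0) := by
      simpa using (hg0.comp hu).mul_const |b - a|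
    refine squeeze_zero_norm (fun T ↦ ?_) h1
    refine intervalIntegral.norm_integral_le_of_norm_le_const fun x hx ↦ ?_
    rw [Set.uIoc_of_le hab] at hx
    simpa using hfg (x + u T * Complex.I) (by simpa using hx.1.le) (by simpa using hx.2)
  have hrect (T : ℝ) : (∫ x in a..b, f (x + (-T : ℝ) * Complex.I)) -
      (∫ x in a..b, f (x + T * Complex.I)) +
      Complex.I • (∫ y in (-T)..T, f (b + y * Complex.I)) -
      Complex.I • (∫ y in (-T)..T, f (a + y * Complex.I)) = 0 := by
    have := Complex.integral_boundary_rect_eq_zero_of_differentiableOn f ⟨a, -T⟩ ⟨b, T⟩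
      (fun s hs ↦ ?_)
    · exact this
    · have h1 : s.re ∈ Set.uIcc a b := hs.1
      rw [Set.uIcc_of_le hab] at h1
      exact (hf s h1.1 h1.2).differentiableWithinAt
  have hlim := (((hhor (tendsto_neg_atTop_atBot.mono_right atBot_le_cocompact)).sub
    (hhor (tendsto_id.mono_right atTop_le_cocompact))).add
    ((hvert b hab le_rfl).const_smul Complex.I)).sub ((hvert a le_rfl hab).const_smul Complex.I)
  have h0 := tendsto_nhds_unique (hlim.congr hrect) tendsto_const_nhds
  rw [sub_zero, zero_add, ← smul_sub, smul_eq_zero] at h0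
  exact (sub_eq_zero.mp (h0.resolve_left Complex.I_ne_zero)).symm

end

/-! ### Recovering the unweighted sum, and the bound under the Riemann hypothesis. -/

section

open Filter Asymptotics Topology MeasureTheory

/-- Interpolation between the mean value bound (weight `1 - κ`) and the trivial bound (weight `κ`).
After division by `s(s+1)` the factor `‖w‖ ^ (1 - κ)` leaves decay `|t|^(-1-κ)`, enough to absorb
growth `|t|^η` when `κ = 2η`, at the price of only `y ^ κ`. -/
lemma norm_cpow_sub_cpow_le {x y : ℝ} (hx : 0 < x) (hxy : x ≤ y) {w : ℂ} (hw : 1 ≤ w.re) {κ : ℝ}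
    (hκ0 : 0 ≤ κ) (hκ1 : κ ≤ 1) :
    ‖(y : ℂ) ^ w - (x : ℂ) ^ w‖ ≤ 2 * ‖w‖ ^ (1 - κ) * (y - x) ^ (1 - κ) * y ^ (w.re - 1 + κ) := by
  have hy : 0 < y := hx.trans_le hxy
  have hyx : 0 ≤ y - x := sub_nonneg.mpr hxy
  have hw0 : w ≠ 0 := by rintro rfl; simp at hw; linarith
  have hA : ‖(y : ℂ) ^ w - (x : ℂ) ^ w‖ ≤ ‖w‖ * y ^ (w.re - 1) * (y - x) := by
    have h := (convex_Icc x y).norm_image_sub_le_of_norm_hasDerivWithin_le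
      (f := fun u : ℝ ↦ (u : ℂ) ^ w) (f' := fun u : ℝ ↦ w * (u : ℂ) ^ (w - 1))
      (C := ‖w‖ * y ^ (w.re - 1)) (x := x) (y := y) (fun u hu ↦ ?_) (fun u hu ↦ ?_)
      ⟨le_rfl, hxy⟩ ⟨hxy, le_rfl⟩
    · simpa [Real.norm_of_nonneg hyx] using h
    · have hu0 : u ≠ 0 := (hx.trans_le hu.1).ne'
      exact (hasDerivAt_ofReal_cpow_const hu0 hw0).hasDerivWithinAt
    · have hu0 : 0 < u := hx.trans_le hu.1
      rw [norm_mul, Complex.norm_cpow_eq_rpow_re_of_pos hu0, Complex.sub_re, Complex.one_re]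
      have h1 : 0 ≤ w.re - 1 := by linarith
      have h2 := hu.2
      gcongr
  have hB : ‖(y : ℂ) ^ w - (x : ℂ) ^ w‖ ≤ 2 * y ^ w.re := by
    refine (norm_sub_le _ _).trans ?_
    rw [Complex.norm_cpow_eq_rpow_re_of_pos hx, Complex.norm_cpow_eq_rpow_re_of_pos hy, two_mul]
    gcongr
  set m := ‖(y : ℂ) ^ w - (x : ℂ) ^ w‖ with hm
  have hm0 : 0 ≤ m := norm_nonneg _
  calc m = m ^ (1 - κ) * m ^ κ := by
        rw [← Real.rpow_add_of_nonneg hm0 (by linarith) hκ0, sub_add_cancel, Real.rpow_one]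
    _ ≤ (‖w‖ * y ^ (w.re - 1) * (y - x)) ^ (1 - κ) * (2 * y ^ w.re) ^ κ := by
        gcongr
    _ = 2 ^ κ * ‖w‖ ^ (1 - κ) * (y - x) ^ (1 - κ) *
        (y ^ ((w.re - 1) * (1 - κ)) * y ^ (w.re * κ)) := by
        rw [Real.mul_rpow (by positivity) hyx, Real.mul_rpow (by positivity) (by positivity),
          Real.mul_rpow (by positivity) (by positivity), ← Real.rpow_mul hy.le,
          ← Real.rpow_mul hy.le]
        ring
    _ = 2 ^ κ * ‖w‖ ^ (1 - κ) * (y - x) ^ (1 - κ) * y ^ (w.re - 1 + κ) := by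
        rw [← Real.rpow_add hy]
        congr 2
        ring
    _ ≤ _ := by
        gcongr
        exact (Real.rpow_le_rpow_of_exponent_le one_le_two hκ1).trans_eq (Real.rpow_one 2)

lemma norm_add_one_rpow_mul_norm_inv_le {s : ℂ} (hs : 1 / 2 ≤ s.re) {κ : ℝ} (hκ0 : 0 ≤ κ)
    (hκ1 : κ ≤ 1) :
    ‖s + 1‖ ^ (1 - κ) * ‖(s * (s + 1))⁻¹‖ ≤ 9 * (1 + |s.im|) ^ (-(1 + κ)) := by
  have h0 : 0 < 1 + |s.im| := by positivity
  have h1 := one_add_abs_im_div_three_le_norm hs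
  have h2 := one_add_abs_im_div_three_le_norm (s := s + 1) (by simp; linarith)
  rw [Complex.add_im, Complex.one_im, add_zero] at h2
  have h3 : 0 < ‖s + 1‖ := lt_of_lt_of_le (by positivity) h2
  have h4 : 0 < ‖s‖ := lt_of_lt_of_le (by positivity) h1
  calc ‖s + 1‖ ^ (1 - κ) * ‖(s * (s + 1))⁻¹‖ = (‖s + 1‖ ^ κ)⁻¹ * ‖s‖⁻¹ := by
        rw [Real.rpow_sub h3, Real.rpow_one, norm_inv, norm_mul]
        field_simp
    _ ≤ (((1 + |s.im|) / 3) ^ κ)⁻¹ * ((1 + |s.im|) / 3)⁻¹ := by gcongr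
    _ = 3 ^ κ * 3 * (1 + |s.im|) ^ (-(1 + κ)) := by
        rw [Real.div_rpow h0.le (by norm_num), Real.rpow_neg h0.le, Real.rpow_add h0, Real.rpow_one]
        field_simp
    _ ≤ 3 * 3 * (1 + |s.im|) ^ (-(1 + κ)) := by
        gcongr
        exact (Real.rpow_le_rpow_of_exponent_le (by norm_num) hκ1).trans_eq (Real.rpow_one 3)
    _ = _ := by ring

/-- Each `n ≤ x` gains exactly weight `h` between the two weighted sums; at most `h + 1` further
terms enter, each of size at most `h`. -/
lemma norm_sum_Icc_le_of_weighted_sum {a : ℕ → ℂ} (ha : ∀ n, ‖a n‖ ≤ 1) {x h : ℝ} (hx : 0 ≤ x)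
    (hh : 0 ≤ h) :
    h * ‖∑ n ∈ Finset.Icc 1 ⌊x⌋₊, a n‖ ≤
      ‖∑ n ∈ Finset.Icc 1 ⌊x + h⌋₊, a n * ((x + h - n : ℝ) : ℂ) -
        ∑ n ∈ Finset.Icc 1 ⌊x⌋₊, a n * ((x - n : ℝ) : ℂ)‖ + (h + 1) * h := by
  have hfl : ⌊x⌋₊ ≤ ⌊x + h⌋₊ := Nat.floor_mono (by linarith)
  have hIcc (n : ℕ) : Finset.Icc 1 n = Finset.Ioc 0 n := rfl
  have heq : (h : ℂ) * ∑ n ∈ Finset.Icc 1 ⌊x⌋₊, a n =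
      (∑ n ∈ Finset.Icc 1 ⌊x + h⌋₊, a n * ((x + h - n : ℝ) : ℂ) -
        ∑ n ∈ Finset.Icc 1 ⌊x⌋₊, a n * ((x - n : ℝ) : ℂ)) -
      ∑ n ∈ Finset.Ioc ⌊x⌋₊ ⌊x + h⌋₊, a n * ((x + h - n : ℝ) : ℂ) := by
    rw [hIcc, hIcc, ← Finset.sum_Ioc_consecutive _ (Nat.zero_le _) hfl, add_sub_right_comm,
      add_sub_cancel_right, ← Finset.sum_sub_distrib, Finset.mul_sum]
    refine Finset.sum_congr rfl fun n _ ↦ ?_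
    push_cast
    ring
  have htail : ‖∑ n ∈ Finset.Ioc ⌊x⌋₊ ⌊x + h⌋₊, a n * ((x + h - n : ℝ) : ℂ)‖ ≤ (h + 1) * h := by
    have hterm : ∀ n ∈ Finset.Ioc ⌊x⌋₊ ⌊x + h⌋₊, ‖a n * ((x + h - n : ℝ) : ℂ)‖ ≤ h := by
      intro n hn
      rw [Finset.mem_Ioc] at hn
      have h1 : x < n := Nat.lt_of_floor_lt hn.1
      have h2 : (n : ℝ) ≤ x + h := (Nat.le_floor_iff (by linarith)).mp hn.2
      rw [norm_mul, Complex.norm_real, Real.norm_of_nonneg (by linarith)]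
      calc ‖a n‖ * (x + h - n) ≤ 1 * (x + h - n) := by
            gcongr
            exact ha n
        _ ≤ h := by linarith
    refine (norm_sum_le_of_le _ hterm).trans ?_
    rw [Finset.sum_const, Nat.card_Ioc, nsmul_eq_mul, Nat.cast_sub hfl]
    have h1 := Nat.floor_le (show 0 ≤ x + h by linarith)
    have h2 := Nat.lt_floor_add_one x
    gcongr
    linarith
  have hnorm : h * ‖∑ n ∈ Finset.Icc 1 ⌊x⌋₊, a n‖ =
      ‖(h : ℂ) * ∑ n ∈ Finset.Icc 1 ⌊x⌋₊, a n‖ := by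
    rw [norm_mul, Complex.norm_real, Real.norm_of_nonneg hh]
  rw [hnorm, heq]
  exact (norm_sub_le _ _).trans (add_le_add_right htail _)

/-- If `∑ a n / n ^ s` with `|a n| ≤ 1` continues holomorphically to `σ ≤ Re s ≤ 2` with growth
`O(|t| ^ η)`, then `∑_{n ≤ x} a n = O(x ^ (σ + 2η))`. -/
theorem exists_norm_sum_le_of_LSeries_growth {a : ℕ → ℂ} (ha : ∀ n, ‖a n‖ ≤ 1) {H : ℂ → ℂ}
    {σ η C : ℝ} (hσ : 1 / 2 ≤ σ) (hη : 0 < η) (hση : σ + 2 * η ≤ 1)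
    (hH : ∀ s : ℂ, σ ≤ s.re → s.re ≤ 2 → DifferentiableAt ℂ H s)
    (hL : ∀ s : ℂ, 1 < s.re → LSeries a s = H s)
    (hHC : ∀ s : ℂ, σ ≤ s.re → s.re ≤ 2 → ‖H s‖ ≤ C * (1 + |s.im|) ^ η) :
    ∃ C' : ℝ, ∀ x : ℝ, 1 ≤ x → ‖∑ k ∈ Finset.Icc 1 ⌊x⌋₊, a k‖ ≤ C' * x ^ (σ + 2 * η) := by
  have hC : 0 ≤ C := by
    have h := (norm_nonneg _).trans (hHC σ (by simp) (by simp; linarith))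
    simpa using h
  set R : ℝ → ℂ := fun X ↦ ∑ n ∈ Finset.Icc 1 ⌊X⌋₊, a n * ((X - n : ℝ) : ℂ) with hR
  have hshift (X : ℝ) (hX : 0 < X) : R X = (2 * Real.pi : ℂ)⁻¹ * ∫ y : ℝ,
      (X : ℂ) ^ ((σ : ℂ) + y * Complex.I + 1) * H ((σ : ℂ) + y * Complex.I) *
        (((σ : ℂ) + y * Complex.I) * ((σ : ℂ) + y * Complex.I + 1))⁻¹ := by
    have hX' : (X : ℂ) ≠ 0 := by exact_mod_cast hX.ne'
    rw [hR]
    simp only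
    rw [sum_mul_sub_eq_integral ha hX]
    congr 1
    have hcont := integral_vertical_line_eq (a := σ) (b := 2)
      (f := fun s ↦ (X : ℂ) ^ (s + 1) * H s * (s * (s + 1))⁻¹) (by linarith)
      -- The exponent 3 bounds `Re (s + 1)` on the strip, and the maximum with 1 covers `X < 1`.
      (g := fun t ↦ (max X 1) ^ (3 : ℝ) * C * 9 * (1 + |t|) ^ (-(2 - η))) ?_ ?_ ?_ ?_
    · rw [hcont]
      congr 1 with y
      rw [hL _ (by simp)]
    · intro s hs hs'
      have h1 : s * (s + 1) ≠ 0 := by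
        refine mul_ne_zero (fun h ↦ ?_) (fun h ↦ ?_)
        · rw [h] at hs
          simp at hs
          linarith
        · have := congrArg Complex.re h
          simp at this
          linarith
      refine DifferentiableAt.fun_mul (DifferentiableAt.fun_mul ?_ (hH s hs hs')) ?_
      · exact (differentiableAt_id.add_const 1).const_cpow (Or.inl hX')
      · exact DifferentiableAt.fun_inv (by fun_prop) h1
    · exact (integrable_one_add_abs_rpow (by linarith)).const_mul _
    · have h1 : Tendsto (fun t : ℝ ↦ 1 + |t|) (cocompact ℝ) atTop :=
        tendsto_atTop_add_const_left _ _ (tendsto_norm_cocompact_atTop (E := ℝ))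
      simpa using ((tendsto_rpow_neg_atTop (by linarith : 0 < 2 - η)).comp h1).const_mul
        ((max X 1) ^ (3 : ℝ) * C * 9)
    · intro s hs hs'
      have h0 : 0 < 1 + |s.im| := by positivity
      have h1 : ‖(X : ℂ) ^ (s + 1)‖ ≤ (max X 1) ^ (3 : ℝ) := by
        rw [Complex.norm_cpow_eq_rpow_re_of_pos hX]
        refine (Real.rpow_le_rpow hX.le (le_max_left X 1) (by simp; linarith)).trans ?_
        refine Real.rpow_le_rpow_of_exponent_le (le_max_right X 1) ?_
        simp
        linarith
      rw [norm_mul, norm_mul]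
      calc _ ≤ (max X 1) ^ (3 : ℝ) * (C * (1 + |s.im|) ^ η) * (9 * (1 + |s.im|) ^ (-2 : ℝ)) := by
            gcongr
            · exact hHC s hs hs'
            · exact inv_norm_mul_norm_add_one_le (by linarith)
        _ = (max X 1) ^ (3 : ℝ) * C * 9 * ((1 + |s.im|) ^ η * (1 + |s.im|) ^ (-2 : ℝ)) := by ring
        _ = _ := by
            rw [← Real.rpow_add h0]
            congr 2
            ring
  have hline (X : ℝ) (hX : 0 < X) : Integrable fun y : ℝ ↦
      (X : ℂ) ^ ((σ : ℂ) + y * Complex.I + 1) * H ((σ : ℂ) + y * Complex.I) *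
        (((σ : ℂ) + y * Complex.I) * ((σ : ℂ) + y * Complex.I + 1))⁻¹ := by
    have hX' : (X : ℂ) ≠ 0 := by exact_mod_cast hX.ne'
    have hcont : Continuous fun y : ℝ ↦ H ((σ : ℂ) + y * Complex.I) := by
      rw [continuous_iff_continuousAt]
      intro y
      exact ContinuousAt.comp (f := fun y : ℝ ↦ (σ : ℂ) + y * Complex.I)
        (hH _ (by simp) (by simp; linarith)).continuousAt (by fun_prop)
    refine Integrable.mono' (g := fun y ↦ X ^ (σ + 1) * C * 9 * (1 + |y|) ^ (-(2 - η)))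
      ((integrable_one_add_abs_rpow (by linarith)).const_mul _) ?_ (ae_of_all _ fun y ↦ ?_)
    · refine (Continuous.aestronglyMeasurable ?_).mul
        (integrable_inv_mul_add_one hσ).aestronglyMeasurable
      exact (Continuous.const_cpow (by fun_prop) (Or.inl hX')).mul hcont
    · have h0 : 0 < 1 + |y| := by positivity
      have h1 := hHC ((σ : ℂ) + y * Complex.I) (by simp) (by simp; linarith)
      have h2 := inv_norm_mul_norm_add_one_le (s := (σ : ℂ) + y * Complex.I) (by simpa using hσ)
      have him : ((σ : ℂ) + y * Complex.I).im = y := by simp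
      rw [him] at h1 h2
      rw [norm_mul, norm_mul, Complex.norm_cpow_eq_rpow_re_of_pos hX]
      have hre : ((σ : ℂ) + y * Complex.I + 1).re = σ + 1 := by simp
      rw [hre]
      calc _ ≤ X ^ (σ + 1) * (C * (1 + |y|) ^ η) * (9 * (1 + |y|) ^ (-2 : ℝ)) := by gcongr
        _ = X ^ (σ + 1) * C * 9 * ((1 + |y|) ^ η * (1 + |y|) ^ (-2 : ℝ)) := by ring
        _ = _ := by
            rw [← Real.rpow_add h0]
            congr 2
            ring
  set I : ℝ := ∫ t : ℝ, (1 + |t|) ^ (-(1 + η)) with hI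
  have hI0 : 0 ≤ I := integral_nonneg fun t ↦ by positivity
  have hdiff (x y : ℝ) (hx : 0 < x) (hxy : x ≤ y) :
      ‖R y - R x‖ ≤ 18 * C * I * ((y - x) ^ (1 - 2 * η) * y ^ (σ + 2 * η)) := by
    have hy : 0 < y := hx.trans_le hxy
    have hyx : 0 ≤ y - x := sub_nonneg.mpr hxy
    rw [hshift y hy, hshift x hx, ← mul_sub, ← integral_sub (hline y hy) (hline x hx), norm_mul]
    have hpi : ‖(2 * Real.pi : ℂ)⁻¹‖ ≤ 1 := by
      rw [norm_inv, norm_mul, Complex.norm_real, Real.norm_of_nonneg Real.pi_pos.le]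
      refine inv_le_one_of_one_le₀ ?_
      have := Real.pi_gt_three
      norm_num
      linarith
    have hbound : ∀ t : ℝ, ‖(y : ℂ) ^ ((σ : ℂ) + t * Complex.I + 1) * H ((σ : ℂ) + t * Complex.I) *
          (((σ : ℂ) + t * Complex.I) * ((σ : ℂ) + t * Complex.I + 1))⁻¹ -
        (x : ℂ) ^ ((σ : ℂ) + t * Complex.I + 1) * H ((σ : ℂ) + t * Complex.I) *
          (((σ : ℂ) + t * Complex.I) * ((σ : ℂ) + t * Complex.I + 1))⁻¹‖ ≤
        18 * C * ((y - x) ^ (1 - 2 * η) * y ^ (σ + 2 * η)) * (1 + |t|) ^ (-(1 + η)) := by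
      intro t
      set s : ℂ := (σ : ℂ) + t * Complex.I with hs
      have hre : s.re = σ := by simp [hs]
      have him : s.im = t := by simp [hs]
      have h0 : 0 < 1 + |t| := by positivity
      have h1 := hHC s hre.ge (by rw [hre]; linarith)
      have h2 := norm_add_one_rpow_mul_norm_inv_le (s := s) (by rwa [hre]) (κ := 2 * η)
        (by linarith) (by linarith)
      have h3 := norm_cpow_sub_cpow_le hx hxy (w := s + 1) (by simp [hre]; linarith) (κ := 2 * η)
        (by linarith) (by linarith)
      rw [him] at h1 h2
      rw [Complex.add_re, hre, Complex.one_re, add_sub_cancel_right] at h3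
      rw [← sub_mul, ← sub_mul, norm_mul, norm_mul]
      calc _ ≤ (2 * ‖s + 1‖ ^ (1 - 2 * η) * (y - x) ^ (1 - 2 * η) * y ^ (σ + 2 * η)) *
            (C * (1 + |t|) ^ η) * ‖(s * (s + 1))⁻¹‖ := by gcongr
        _ = 2 * C * ((y - x) ^ (1 - 2 * η) * y ^ (σ + 2 * η)) * (1 + |t|) ^ η *
            (‖s + 1‖ ^ (1 - 2 * η) * ‖(s * (s + 1))⁻¹‖) := by ring
        _ ≤ 2 * C * ((y - x) ^ (1 - 2 * η) * y ^ (σ + 2 * η)) * (1 + |t|) ^ η *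
            (9 * (1 + |t|) ^ (-(1 + 2 * η))) := by gcongr
        _ = 18 * C * ((y - x) ^ (1 - 2 * η) * y ^ (σ + 2 * η)) *
            ((1 + |t|) ^ η * (1 + |t|) ^ (-(1 + 2 * η))) := by ring
        _ = _ := by
            rw [← Real.rpow_add h0]
            congr 2
            ring
    have hint := norm_integral_le_of_norm_le
      ((integrable_one_add_abs_rpow (by linarith : 1 < 1 + η)).const_mul
        (18 * C * ((y - x) ^ (1 - 2 * η) * y ^ (σ + 2 * η)))) (ae_of_all _ hbound)
    rw [integral_const_mul] at hint
    refine (mul_le_of_le_one_left (norm_nonneg _) hpi).trans (hint.trans_eq ?_)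
    rw [← hI]
    ring
  refine ⟨36 * C * I + 2, fun x hx ↦ ?_⟩
  have hx0 : 0 < x := by linarith
  -- Any `h` with `1 ≤ h ≤ x ^ (σ + 2 * η)` would serve: the main term is proportional to `h ^ (1 -
  -- 2 * η) ≤ h`, and the tail divided by `h` is `h + 1`.
  set h : ℝ := √x with hh
  have hh1 : 1 ≤ h := Real.one_le_sqrt.mpr hx
  have hh0 : 0 < h := by linarith
  have hhx : h ≤ x := Real.sqrt_le_iff.mpr ⟨hx0.le, by nlinarith⟩
  have hle := norm_sum_Icc_le_of_weighted_sum ha hx0.le hh0.le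
  have hd := hdiff x (x + h) hx0 (by linarith)
  rw [add_sub_cancel_left] at hd
  have hhp : h ^ (1 - 2 * η) ≤ h :=
    (Real.rpow_le_rpow_of_exponent_le hh1 (by linarith)).trans_eq (Real.rpow_one h)
  have hxp : (x + h) ^ (σ + 2 * η) ≤ 2 * x ^ (σ + 2 * η) := by
    calc (x + h) ^ (σ + 2 * η) ≤ (2 * x) ^ (σ + 2 * η) := by
          gcongr
          linarith
      _ = 2 ^ (σ + 2 * η) * x ^ (σ + 2 * η) := Real.mul_rpow (by norm_num) hx0.le
      _ ≤ _ := by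
          gcongr
          exact (Real.rpow_le_rpow_of_exponent_le one_le_two hση).trans_eq (Real.rpow_one 2)
  have hsq : h ≤ x ^ (σ + 2 * η) := by
    rw [hh, Real.sqrt_eq_rpow]
    exact Real.rpow_le_rpow_of_exponent_le hx (by linarith)
  have hmain : h * ‖∑ n ∈ Finset.Icc 1 ⌊x⌋₊, a n‖ ≤ h * ((36 * C * I + 2) * x ^ (σ + 2 * η)) := by
    calc _ ≤ 18 * C * I * (h ^ (1 - 2 * η) * (x + h) ^ (σ + 2 * η)) + (h + 1) * h :=
          hle.trans (add_le_add_left hd _)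
      _ ≤ 18 * C * I * (h * (2 * x ^ (σ + 2 * η))) + (2 * x ^ (σ + 2 * η)) * h := by
          gcongr
          linarith
      _ = _ := by ring
  exact le_of_mul_le_mul_left hmain hh0

theorem exists_abs_sumLiouvilleAP_two_one_le (RH : RiemannHypothesis) {ε : ℝ} (hε : 0 < ε) :
    ∃ C : ℝ, ∀ x : ℝ, 1 ≤ x → |(sumLiouvilleAP x 2 1 : ℝ)| ≤ C * x ^ (1 / 2 + ε) := by
  -- With `σ = 1/2 + 2δ` and `η = δ` the final exponent is `1/2 + 4δ`, which must be at most both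
  -- `1/2 + ε` and 1.
  set δ : ℝ := min ε (1 / 2) / 4 with hδ
  have hmin : 0 < min ε (1 / 2) := lt_min hε (by norm_num)
  have hδ0 : 0 < δ := by positivity
  have hδ1 : 4 * δ ≤ 1 / 2 := by
    have := min_le_right ε (1 / 2)
    linarith
  have hδε : 4 * δ ≤ ε := by
    have := min_le_left ε (1 / 2)
    linarith
  obtain ⟨C, -, hC⟩ := exists_norm_liouvilleSeries_le RH hδ0 (by linarith) hδ0
  obtain ⟨C', hC'⟩ := exists_norm_sum_le_of_LSeries_growth (a := fun n ↦ (liouvilleAP n 2 1 : ℂ))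
    (fun n ↦ (norm_liouvilleAP n 2 1).le) (H := liouvilleSeries) (σ := 1 / 2 + 2 * δ)
    (by linarith) hδ0 (by linarith)
    (fun s hs _ ↦ differentiableAt_liouvilleSeries (by linarith)
      (riemannZeta₁_ne_zero_of_riemannHypothesis RH (by linarith)))
    (fun s hs ↦ LSeries_liouvilleAP_eq hs) hC
  refine ⟨|C'|, fun x hx ↦ ?_⟩
  rw [← norm_sum_liouvilleAP]
  refine (hC' x hx).trans ?_
  exact mul_le_mul (le_abs_self C') (Real.rpow_le_rpow_of_exponent_le hx (by linarith))
    (by positivity) (abs_nonneg C')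

end

theorem mainTheorem6 :
    (RiemannHypothesis → ∀ ε : ℝ, 0 < ε → ∃ C : ℝ, ∀ x : ℝ, 1 ≤ x →
      |(sumLiouvilleAP x 2 1 : ℝ)| ≤ C * x ^ (1 / 2 + ε)) ∧
    (fun x : ℝ => (sumLiouvilleAP x 2 1 : ℝ)) =o[Filter.atTop] (fun x : ℝ => x) ∧
    (fun x : ℝ => (sumLiouvilleAP x 2 2 : ℝ) - 1 / 3 * x) =o[Filter.atTop] (fun x : ℝ => x) ∧
    (∀ x : ℝ, 1 ≤ x → 0 ≤ sumLiouvilleAP x 2 2) :=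
  ⟨fun RH _ hε ↦ exists_abs_sumLiouvilleAP_two_one_le RH hε, sumLiouvilleAP_two_one_isLittleO,
    sumLiouvilleAP_two_two_isLittleO, fun x _ ↦ sumLiouvilleAP_two_two_nonneg x⟩
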